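/- Let $N\in\mathbf N$, $0\le N_1\le N$, and $\vec p=(p_1,\dots,p_N)$ with $p_i=1$ for $i\le N_1$ and $p_i>1$ for $i>N_1$. Assume $\sum_{i=1}^N\frac1{p_i}>1$, put $p^*=\dfrac{N}{\sum_{i=1}^N\frac1{p_i}-1}$, and assume $\max_i p_i<p^*$. Let $\mathcal D(\mathbf R^N)$ be the space of real smooth compactly supported functions, $M^1(\mathbf R^N)$ the space of bounded (signed) Radon measures, $\nabla_1u=(\partial_1u,\dots,\partial_{N_1}u)$, and $$BV^{\vec p}(\mathbf R^N)=\{u\in L^{p^*}(\mathbf R^N):\ \partial_iu\in M^1(\mathbf R^N)\ (i\le N_1),\ \partial_iu\in L^{p_i}(\mathbf R^N)\ (i>N_1)\},$$ with derivatives in the sense of distributions. For $u\in BV^{\vec p}$, $\int|\nabla_1u|$ denotes the total mass of the measure $|\nabla_1u|=(\sum_{i\le N_1}(\partial_iu)^2)^{1/2}$, i.e. the supremum of $\sum_{i\le N_1}\langle\partial_iu,\psi_i\rangle$ over continuous compactly supported $\psi$ with $\sum_{i\le N_1}\psi_i^2\le1$; $|\nabla_1 u|_1$ denotes the same number, and $|\partial_iu|_{p_i}$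 is the total mass of $\partial_iu$ if $i\le N_1$ and its $L^{p_i}$ norm if $i>N_1$. A sequence $u_n\in BV^{\vec p}$ converges *weakly* to $u\in BV^{\vec p}$ if $u_n\rightharpoonup u$ weakly in $L^{p^*}$, $\int\varphi\,d(\partial_iu_n)\to\int\varphi\,d(\partial_iu)$ for every $\varphi\in\mathcal C_c(\mathbf R^N)$ and every $i\le N_1$, and $\partial_iu_n\rightharpoonup\partial_iu$ weakly in $L^{p_i}$ for every $i>N_1$. It converges *tightly* if, furthermore, $\int|\partial_iu_n|^{p_i}\to\int|\partial_iu|^{p_i}$ for every $i>N_1$ and $\int|\nabla_1u_n|\to\int|\nabla_1u|$. **(A)** For every $u:\mathbf R^N\to\mathbf R$ the following are equivalent: 1. $u\in BV^{\vec p}(\mathbf R^N)$; 2. there are $u_n\in\mathcal D(\mathbf R^N)$ converging tightly to $u$; 3. there are $u_n\in\mathcal D(\mathbf R^N)$ converging weakly to $u$; 4. $u$ is locally integrable and there are $u_n\in\mathcal D(\mathbf R^N)$ converging to $u$ in the sense of distributions, with $|\nabla_1u_n|_1+\sum_{i>N_1}|\partial_iu_n|_{p_i}$ bounded independently of $n$.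 **(B)** The Troisi embedding extends to $BV^{\vec p}$: there is $T_0>0$, depending only on $N,N_1,\vec p$, such that for all $u\in BV^{\vec p}(\mathbf R^N)$ $$T_0\,|u|_{p^*}\le\prod_{i=1}^N|\partial_iu|_{p_i}^{1/N}\quad\text{and}\quad |u|_{p^*}\le\frac1{T_0N}\Big(\sqrt{N_1}\,|\nabla_1u|_1+\sum_{i=N_1+1}^N|\partial_iu|_{p_i}\Big).$$ Moreover, every constant $T_0>0$ for which the first inequality holds for all $u\in\mathcal D(\mathbf R^N)$ is such that both inequalities hold for all $u\in BV^{\vec p}(\mathbf R^N)$. -/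

import Mathlib

open MeasureTheory Filter Topology
open scoped ENNReal ContDiff

namespace AnisoBV

/-- Real test functions on `ℝ^N`: smooth with compact support. -/
def IsTest {N : ℕ} (φ : EuclideanSpace ℝ (Fin N) → ℝ) : Prop :=
  ContDiff ℝ ∞ φ ∧ HasCompactSupport φ

/-- The classical partial derivative in the `i`-th coordinate direction. -/
noncomputable def pderiv {N : ℕ} (i : Fin N) (φ : EuclideanSpace ℝ (Fin N) → ℝ)
    (x : EuclideanSpace ℝ (Fin N)) : ℝ :=
  fderiv ℝ φ x (EuclideanSpace.single i 1)

/-- The critical exponent `p* = N / (∑ 1/p_i - 1)`. -/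
noncomputable def critExp {N : ℕ} (p : Fin N → ℝ) : ℝ :=
  (N : ℝ) / ((∑ i, 1 / p i) - 1)

/-- The first `N₁` coordinate indices. -/
def firstIdx (N N₁ : ℕ) : Finset (Fin N) :=
  Finset.univ.filter fun i => (i : ℕ) < N₁

/-- The remaining coordinate indices. -/
def lastIdx (N N₁ : ℕ) : Finset (Fin N) :=
  Finset.univ.filter fun i => N₁ ≤ (i : ℕ)

/-- The bounded measure `μ` is the `i`-th partial derivative of `u` in the sense of
distributions. -/
def HasMeasureDeriv {N : ℕ} (u : EuclideanSpace ℝ (Fin N) → ℝ) (i : Fin N)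
    (μ : SignedMeasure (EuclideanSpace ℝ (Fin N))) : Prop :=
  ∀ φ : EuclideanSpace ℝ (Fin N) → ℝ, IsTest φ →
    ∫ x, u x * pderiv i φ x = - ∫ᵛ x, φ x ∂<•μ

/-- The function `g` is the `i`-th partial derivative of `u` in the sense of distributions. -/
def HasWeakDeriv {N : ℕ} (u : EuclideanSpace ℝ (Fin N) → ℝ) (i : Fin N)
    (g : EuclideanSpace ℝ (Fin N) → ℝ) : Prop :=
  ∀ φ : EuclideanSpace ℝ (Fin N) → ℝ, IsTest φ →
    ∫ x, u x * pderiv i φ x = - ∫ x, g x * φ x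

/-- `BV^p(ℝ^N)`: functions `u ∈ L^{p*}` such that `∂_i u` is a bounded measure for the first `N₁`
indices and `∂_i u ∈ L^{p_i}` for the others. -/
def BV {N : ℕ} (N₁ : ℕ) (p : Fin N → ℝ) : Set (EuclideanSpace ℝ (Fin N) → ℝ) :=
  {u | MemLp u (ENNReal.ofReal (critExp p)) volume ∧
    (∀ i ∈ firstIdx N N₁, ∃ μ : SignedMeasure (EuclideanSpace ℝ (Fin N)), HasMeasureDeriv u i μ) ∧
    (∀ i ∈ lastIdx N N₁, ∃ g : EuclideanSpace ℝ (Fin N) → ℝ,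
      MemLp g (ENNReal.ofReal (p i)) volume ∧ HasWeakDeriv u i g)}

/-- The family of the partial derivatives of a function: `meas i` is meant to be `∂_i u` for the
first `N₁` indices and `func i` to be `∂_i u` for the others (the other entries play no role). -/
structure Grad (N : ℕ) where
  meas : Fin N → SignedMeasure (EuclideanSpace ℝ (Fin N))
  func : Fin N → EuclideanSpace ℝ (Fin N) → ℝ

/-- `u` belongs to `BV^p(ℝ^N)`, with the partial derivatives `D`. -/
structure IsBVGrad {N : ℕ} (N₁ : ℕ) (p : Fin N → ℝ) (u : EuclideanSpace ℝ (Fin N) → ℝ)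
    (D : Grad N) : Prop where
  memLp : MemLp u (ENNReal.ofReal (critExp p)) volume
  meas : ∀ i ∈ firstIdx N N₁, HasMeasureDeriv u i (D.meas i)
  func_memLp : ∀ i ∈ lastIdx N N₁, MemLp (D.func i) (ENNReal.ofReal (p i)) volume
  func : ∀ i ∈ lastIdx N N₁, HasWeakDeriv u i (D.func i)

theorem mem_BV_iff {N : ℕ} {N₁ : ℕ} {p : Fin N → ℝ} {u : EuclideanSpace ℝ (Fin N) → ℝ} :
    u ∈ BV N₁ p ↔ ∃ D : Grad N, IsBVGrad N₁ p u D := by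
  classical
  constructor
  · rintro ⟨h, h1, h2⟩
    choose! μ hμ using h1
    choose! g hg using h2
    exact ⟨⟨μ, g⟩, h, hμ, fun i hi => (hg i hi).1, fun i hi => (hg i hi).2⟩
  · rintro ⟨D, h⟩
    exact ⟨h.memLp, fun i hi => ⟨_, h.meas i hi⟩, fun i hi => ⟨_, h.func_memLp i hi, h.func i hi⟩⟩

/-- The total mass `∫ |μ|` of the vector measure `(μ_i)_{i ∈ S}`, where
`|μ| = (∑_{i ∈ S} μ_i²)^{1/2}`: the supremum of `∑ ⟨μ_i, ψ_i⟩` over the continuous compactly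
supported fields `ψ` with `∑_{i ∈ S} ψ_i² ≤ 1`. -/
noncomputable def totalMass {N : ℕ} (S : Finset (Fin N))
    (μ : Fin N → SignedMeasure (EuclideanSpace ℝ (Fin N))) : ℝ≥0∞ :=
  ⨆ ψ ∈ {ψ : Fin N → EuclideanSpace ℝ (Fin N) → ℝ |
      (∀ i, Continuous (ψ i) ∧ HasCompactSupport (ψ i)) ∧ ∀ x, ∑ i ∈ S, ψ i x ^ 2 ≤ 1},
    ENNReal.ofReal (∑ i ∈ S, ∫ᵛ x, ψ i x ∂<•(μ i))

/-- `∫ |∇₁ u|`, where `∇₁ u = (∂_1 u, …, ∂_{N₁} u)`. -/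
noncomputable def mass₁ {N : ℕ} (N₁ : ℕ) (D : Grad N) : ℝ≥0∞ :=
  totalMass (firstIdx N N₁) D.meas

/-- `|∂_i u|_{p_i}`: the total mass of `∂_i u` for the first `N₁` indices and the norm in `L^{p_i}`
for the others. -/
noncomputable def derivNorm {N : ℕ} (N₁ : ℕ) (p : Fin N → ℝ) (D : Grad N) (i : Fin N) : ℝ≥0∞ :=
  if (i : ℕ) < N₁ then totalMass {i} D.meas
  else eLpNorm (D.func i) (ENNReal.ofReal (p i)) volume

/-- Weak convergence in `L^q(ℝ^N)`, `1 < q < ∞`. -/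
def WeakLp {N : ℕ} (q : ℝ) (f : ℕ → EuclideanSpace ℝ (Fin N) → ℝ)
    (g : EuclideanSpace ℝ (Fin N) → ℝ) : Prop :=
  ∀ v : EuclideanSpace ℝ (Fin N) → ℝ, MemLp v (ENNReal.ofReal (q / (q - 1))) volume →
    Tendsto (fun n => ∫ x, f n x * v x) atTop (𝓝 (∫ x, g x * v x))

/-- Vague convergence of bounded measures. -/
def Vague {N : ℕ} (μs : ℕ → SignedMeasure (EuclideanSpace ℝ (Fin N)))
    (μ : SignedMeasure (EuclideanSpace ℝ (Fin N))) : Prop :=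
  ∀ φ : EuclideanSpace ℝ (Fin N) → ℝ, Continuous φ → HasCompactSupport φ →
    Tendsto (fun n => ∫ᵛ x, φ x ∂<•(μs n)) atTop (𝓝 (∫ᵛ x, φ x ∂<•μ))

/-- Weak convergence in `BV^p`, for functions with given partial derivatives. -/
structure WeakConvGrad {N : ℕ} (N₁ : ℕ) (p : Fin N → ℝ)
    (us : ℕ → EuclideanSpace ℝ (Fin N) → ℝ) (Ds : ℕ → Grad N)
    (u : EuclideanSpace ℝ (Fin N) → ℝ) (D : Grad N) : Prop where
  seq_grad : ∀ n, IsBVGrad N₁ p (us n) (Ds n)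
  lim_grad : IsBVGrad N₁ p u D
  weak : WeakLp (critExp p) us u
  vague : ∀ i ∈ firstIdx N N₁, Vague (fun n => (Ds n).meas i) (D.meas i)
  weak_deriv : ∀ i ∈ lastIdx N N₁, WeakLp (p i) (fun n => (Ds n).func i) (D.func i)

/-- `us n` converges weakly to `u` in `BV^p(ℝ^N)`. -/
def ConvergesWeakly {N : ℕ} (N₁ : ℕ) (p : Fin N → ℝ)
    (us : ℕ → EuclideanSpace ℝ (Fin N) → ℝ) (u : EuclideanSpace ℝ (Fin N) → ℝ) : Prop :=
  ∃ (Ds : ℕ → Grad N) (D : Grad N), WeakConvGrad N₁ p us Ds u D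

/-- `us n` converges tightly to `u` in `BV^p(ℝ^N)`. -/
def ConvergesTightly {N : ℕ} (N₁ : ℕ) (p : Fin N → ℝ)
    (us : ℕ → EuclideanSpace ℝ (Fin N) → ℝ) (u : EuclideanSpace ℝ (Fin N) → ℝ) : Prop :=
  ∃ (Ds : ℕ → Grad N) (D : Grad N), WeakConvGrad N₁ p us Ds u D ∧
    (∀ i ∈ lastIdx N N₁,
      Tendsto (fun n => ∫ x, |(Ds n).func i x| ^ p i) atTop (𝓝 (∫ x, |D.func i x| ^ p i))) ∧
    Tendsto (fun n => mass₁ N₁ (Ds n)) atTop (𝓝 (mass₁ N₁ D))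

/-- The norm `|∇₁ φ|_1 + ∑_{i > N₁} |∂_i φ|_{p_i}` of a test function. -/
noncomputable def testNorm {N : ℕ} (N₁ : ℕ) (p : Fin N → ℝ)
    (φ : EuclideanSpace ℝ (Fin N) → ℝ) : ℝ≥0∞ :=
  eLpNorm (fun x => √(∑ i ∈ firstIdx N N₁, pderiv i φ x ^ 2)) 1 volume +
    ∑ i ∈ lastIdx N N₁, eLpNorm (pderiv i φ) (ENNReal.ofReal (p i)) volume

/-- Convergence to a locally integrable function in the sense of distributions. -/
def ConvergesInDistributions {N : ℕ} (us : ℕ → EuclideanSpace ℝ (Fin N) → ℝ)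
    (u : EuclideanSpace ℝ (Fin N) → ℝ) : Prop :=
  LocallyIntegrable u volume ∧
    ∀ φ : EuclideanSpace ℝ (Fin N) → ℝ, IsTest φ →
      Tendsto (fun n => ∫ x, us n x * φ x) atTop (𝓝 (∫ x, u x * φ x))

/-- The two Troisi inequalities with constant `T₀` for a function `u` of `BV^p(ℝ^N)` with
the partial derivatives `D`. -/
def TroisiIneq {N : ℕ} (N₁ : ℕ) (p : Fin N → ℝ) (T₀ : ℝ)
    (u : EuclideanSpace ℝ (Fin N) → ℝ) (D : Grad N) : Prop :=
  ENNReal.ofReal T₀ * eLpNorm u (ENNReal.ofReal (critExp p)) volume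
      ≤ ∏ i, derivNorm N₁ p D i ^ (1 / (N : ℝ)) ∧
  eLpNorm u (ENNReal.ofReal (critExp p)) volume
      ≤ ENNReal.ofReal (1 / (T₀ * N)) *
        (ENNReal.ofReal √(N₁ : ℝ) * mass₁ N₁ D + ∑ i ∈ lastIdx N N₁, derivNorm N₁ p D i)

end AnisoBV

open AnisoBV

/-!
Approximation. Write `1/p_i = a_i + 1/p*`, so that `a_i > 0` and `∑ a_i = 1`. Mollify `u` and
multiply by the cutoffs `η_R(x) = η(x_1 / R^{a_1}, …, x_N / R^{a_N})`. The only error term that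
mollification does not control is `∂_i η_R · u`, and by Hölder's inequality its `L^{p_i}` norm is at
most `‖∂_i η_R‖_{L^{1/a_i}} ‖u‖_{p*}` on the region where `η_R` is not constant. The dilation has
Jacobian `R^{∑ a_i} = R`, so `‖∂_i η_R‖_{L^{1/a_i}} = R^{-a_i} R^{a_i} ‖∂_i η‖_{L^{1/a_i}}` stays
bounded while `u` has vanishing norm on that region. The masses of the approximations exceed those
of `u` by errors tending to `0`, and lower semicontinuity gives the reverse bound, hence tight
convergence.

Compactness. The Troisi inequality for test functions comes from the Gagliardo argument: each
`|φ|^{γ_i}` is bounded by the integral of its derivative along the `i`-th axis, and the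
Loomis–Whitney inequality combines these bounds. So a sequence of test functions with bounded
`testNorm` is bounded in `L^{p*}`, and limits along an ultrafilter, represented by the Riesz
theorem, identify `u` and its derivatives.

Troisi inequalities. The product form passes to the limit along the approximations; the sum form
follows from it by the inequality of arithmetic and geometric means, where
`∑_{i ≤ N₁} |∂_i u|_1 ≤ √N₁ |∇₁ u|_1` by the Cauchy–Schwarz inequality.
-/

namespace AnisoBV

local notation "ℝ^" n:max => EuclideanSpace ℝ (Fin n)

open scoped Convolution

variable {N : ℕ}

/-! ### Signed measures and total mass -/

section SignedMeasure

variable {X : Type*} [MeasurableSpace X]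

instance isFiniteMeasure_variation (μ : SignedMeasure X) : IsFiniteMeasure μ.variation := by
  rw [← μ.totalVariation_eq_variation]
  infer_instance

theorem abs_integral_signedMeasure_le (μ : SignedMeasure X) {φ : X → ℝ} {C : ℝ}
    (hφ : ∀ x, |φ x| ≤ C) : |∫ᵛ x, φ x ∂<•μ| ≤ C * μ.variation.real Set.univ := by
  have h := VectorMeasure.norm_integral_le_of_norm_le_const (μ := μ)
    (B := (ContinuousLinearMap.lsmul ℝ ℝ).flip) (f := φ) (ae_of_all _ hφ)
  rwa [ContinuousLinearMap.opNorm_flip, ContinuousLinearMap.opNorm_lsmul, mul_one] at h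

theorem integral_withDensity_ofReal (ν : Measure X) {g : X → ℝ} (hg : AEMeasurable g ν)
    (φ : X → ℝ) :
    ∫ x, φ x ∂(ν.withDensity fun x => ENNReal.ofReal (g x)) = ∫ x, max (g x) 0 * φ x ∂ν := by
  rw [integral_withDensity_eq_integral_toReal_smul₀ hg.ennreal_ofReal
    (ae_of_all _ fun _ => ENNReal.ofReal_lt_top)]
  simp only [ENNReal.toReal_ofReal', smul_eq_mul]

theorem integral_withDensityᵥ {ν : Measure X} {g φ : X → ℝ} (hg : Integrable g ν)
    (hφ : Measurable φ) {C : ℝ} (hC : ∀ x, |φ x| ≤ C) :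
    ∫ᵛ x, φ x ∂<•(ν.withDensityᵥ g) = ∫ x, g x * φ x ∂ν := by
  have : IsFiniteMeasure (ν.withDensity fun x => ENNReal.ofReal (g x)) :=
    isFiniteMeasure_withDensity_ofReal hg.2
  have : IsFiniteMeasure (ν.withDensity fun x => ENNReal.ofReal (-g x)) :=
    isFiniteMeasure_withDensity_ofReal hg.neg.2
  have hint (m : Measure X) [IsFiniteMeasure m] : m.toSignedMeasure.Integrable φ := by
    rw [VectorMeasure.Integrable, Measure.variation_toSignedMeasure]
    exact Integrable.of_bound hφ.aestronglyMeasurable C (ae_of_all _ hC)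
  have hpart {f : X → ℝ} (hf : Integrable f ν) : Integrable (fun x => max (f x) 0 * φ x) ν :=
    hf.pos_part.mul_bdd (c := C) hφ.aestronglyMeasurable (ae_of_all _ hC)
  rw [withDensityᵥ_eq_withDensity_pos_part_sub_withDensity_neg_part hg,
    VectorMeasure.integral_sub_vectorMeasure (hint _) (hint _),
    VectorMeasure.integral_toSignedMeasure, VectorMeasure.integral_toSignedMeasure,
    integral_withDensity_ofReal ν hg.1.aemeasurable,
    integral_withDensity_ofReal ν (g := fun x => -g x) hg.1.aemeasurable.neg,
    ← integral_sub (hpart hg) (hpart (f := fun x => -g x) hg.neg)]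
  simp only [← sub_mul, max_zero_sub_max_neg_zero_eq_self]

end SignedMeasure

/-- The fields admissible in the supremum `totalMass S`: continuous, compactly supported, with
`∑_{i ∈ S} ψ_i² ≤ 1`. -/
def UnitFields (S : Finset (Fin N)) : Set (Fin N → ℝ^N → ℝ) :=
  {ψ | (∀ i, Continuous (ψ i) ∧ HasCompactSupport (ψ i)) ∧ ∀ x, ∑ i ∈ S, ψ i x ^ 2 ≤ 1}

section TotalMass

variable {S : Finset (Fin N)} {μ : Fin N → SignedMeasure (ℝ^N)}

theorem abs_le_one_of_mem_unitFields {ψ : Fin N → ℝ^N → ℝ} (hψ : ψ ∈ UnitFields S) {i : Fin N}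
    (hi : i ∈ S) (x : ℝ^N) : |ψ i x| ≤ 1 := by
  rw [← sq_le_one_iff_abs_le_one]
  exact (Finset.single_le_sum (f := fun i => ψ i x ^ 2) (fun _ _ => sq_nonneg _) hi).trans (hψ.2 x)

theorem le_totalMass (μ : Fin N → SignedMeasure (ℝ^N)) {ψ : Fin N → ℝ^N → ℝ}
    (hψ : ψ ∈ UnitFields S) :
    ENNReal.ofReal (∑ i ∈ S, ∫ᵛ x, ψ i x ∂<•(μ i)) ≤ totalMass S μ :=
  le_iSup₂_of_le ψ hψ le_rfl

theorem totalMass_le {C : ℝ≥0∞}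
    (h : ∀ ψ ∈ UnitFields S, ENNReal.ofReal (∑ i ∈ S, ∫ᵛ x, ψ i x ∂<•(μ i)) ≤ C) :
    totalMass S μ ≤ C :=
  iSup₂_le h

theorem totalMass_lt_top (S : Finset (Fin N)) (μ : Fin N → SignedMeasure (ℝ^N)) :
    totalMass S μ < ⊤ := by
  refine (totalMass_le (C := ENNReal.ofReal (∑ i ∈ S, (μ i).variation.real Set.univ))
    fun ψ hψ => ENNReal.ofReal_le_ofReal (Finset.sum_le_sum fun i hi => ?_)).trans_lt
    ENNReal.ofReal_lt_top
  have h := abs_integral_signedMeasure_le (μ i) (abs_le_one_of_mem_unitFields hψ hi)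
  rw [one_mul] at h
  exact (le_abs_self _).trans h

theorem totalMass_le_liminf {μs : ℕ → Fin N → SignedMeasure (ℝ^N)}
    (h : ∀ i ∈ S, Vague (fun n => μs n i) (μ i)) :
    totalMass S μ ≤ liminf (fun n => totalMass S (μs n)) atTop := by
  refine totalMass_le fun ψ hψ => ?_
  have hlim : Tendsto (fun n => ENNReal.ofReal (∑ i ∈ S, ∫ᵛ x, ψ i x ∂<•(μs n i))) atTop
      (𝓝 (ENNReal.ofReal (∑ i ∈ S, ∫ᵛ x, ψ i x ∂<•(μ i)))) :=
    ENNReal.tendsto_ofReal (tendsto_finsetSum _ fun i hi => h i hi _ (hψ.1 i).1 (hψ.1 i).2)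
  rw [← hlim.liminf_eq]
  exact liminf_le_liminf (Eventually.of_forall fun n => le_totalMass _ hψ)

theorem tendsto_totalMass {μs : ℕ → Fin N → SignedMeasure (ℝ^N)}
    (h : ∀ i ∈ S, Vague (fun n => μs n i) (μ i)) {ε : ℕ → ℝ≥0∞} (hε : Tendsto ε atTop (𝓝 0))
    (hle : ∀ n, totalMass S (μs n) ≤ totalMass S μ + ε n) :
    Tendsto (fun n => totalMass S (μs n)) atTop (𝓝 (totalMass S μ)) := by
  have hlim : Tendsto (fun n => totalMass S μ + ε n) atTop (𝓝 (totalMass S μ)) := by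
    simpa only [add_zero] using tendsto_const_nhds.add hε
  refine tendsto_of_le_liminf_of_limsup_le (totalMass_le_liminf h) ?_
  rw [← hlim.limsup_eq]
  exact limsup_le_limsup (Eventually.of_forall hle)

theorem exists_totalMass_singleton_le_add (μ : Fin N → SignedMeasure (ℝ^N)) (i : Fin N)
    {ε : ℝ≥0∞} (hε : ε ≠ 0) :
    ∃ ψ : ℝ^N → ℝ, (Continuous ψ ∧ HasCompactSupport ψ) ∧ (∀ x, ψ x ^ 2 ≤ 1) ∧
      0 ≤ ∫ᵛ x, ψ x ∂<•(μ i) ∧ totalMass {i} μ ≤ ENNReal.ofReal (∫ᵛ x, ψ x ∂<•(μ i)) + ε := by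
  rcases eq_or_ne (totalMass {i} μ) 0 with h0 | h0
  · exact ⟨0, ⟨continuous_zero, HasCompactSupport.zero⟩, by simp, by simp, by simp [h0]⟩
  obtain ⟨ψ, h⟩ := lt_iSup_iff.1 (ENNReal.sub_lt_self (totalMass_lt_top {i} μ).ne h0 hε)
  obtain ⟨hψ, hlt⟩ := lt_iSup_iff.1 h
  rw [Finset.sum_singleton] at hlt
  exact ⟨ψ i, hψ.1 i, fun x => by simpa using hψ.2 x,
    (ENNReal.ofReal_pos.1 (bot_le.trans_lt hlt)).le, tsub_le_iff_right.1 hlt.le⟩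

theorem ofReal_sum_integral_le_sqrt_card_mul_totalMass (S : Finset (Fin N))
    (μ : Fin N → SignedMeasure (ℝ^N)) {ψ : Fin N → ℝ^N → ℝ}
    (hψ : ∀ i, Continuous (ψ i) ∧ HasCompactSupport (ψ i)) (hle : ∀ i x, ψ i x ^ 2 ≤ 1) :
    ENNReal.ofReal (∑ i ∈ S, ∫ᵛ x, ψ i x ∂<•(μ i)) ≤ ENNReal.ofReal √S.card * totalMass S μ := by
  rcases S.eq_empty_or_nonempty with rfl | hS
  · simp
  have hcard : (0 : ℝ) < S.card := mod_cast hS.card_pos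
  set c : ℝ := √S.card
  have hc : 0 < c := Real.sqrt_pos.2 hcard
  have hfield : (fun i x => c⁻¹ * ψ i x) ∈ UnitFields S := by
    refine ⟨fun i => ⟨continuous_const.mul (hψ i).1, (hψ i).2.mul_left⟩, fun x => ?_⟩
    calc ∑ i ∈ S, (c⁻¹ * ψ i x) ^ 2
        ≤ ∑ _i ∈ S, (S.card : ℝ)⁻¹ := Finset.sum_le_sum fun i _ => by
          rw [mul_pow, inv_pow, Real.sq_sqrt hcard.le]
          exact mul_le_of_le_one_right (by positivity) (hle i x)
      _ = 1 := by simp [hcard.ne']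
  have hscale : ∀ i, ∫ᵛ x, c⁻¹ * ψ i x ∂<•(μ i) = c⁻¹ * ∫ᵛ x, ψ i x ∂<•(μ i) := fun i =>
    VectorMeasure.integral_fun_smul (μ := μ i) (B := (ContinuousLinearMap.lsmul ℝ ℝ).flip)
      c⁻¹ (ψ i)
  calc ENNReal.ofReal (∑ i ∈ S, ∫ᵛ x, ψ i x ∂<•(μ i))
      = ENNReal.ofReal c * ENNReal.ofReal (∑ i ∈ S, ∫ᵛ x, c⁻¹ * ψ i x ∂<•(μ i)) := by
        simp_rw [hscale]
        rw [← Finset.mul_sum, ← ENNReal.ofReal_mul hc.le, mul_inv_cancel_left₀ hc.ne']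
    _ ≤ ENNReal.ofReal c * totalMass S μ := by gcongr; exact le_totalMass μ hfield

theorem sum_totalMass_singleton_le (S : Finset (Fin N)) (μ : Fin N → SignedMeasure (ℝ^N)) :
    ∑ i ∈ S, totalMass {i} μ ≤ ENNReal.ofReal √S.card * totalMass S μ := by
  rcases S.eq_empty_or_nonempty with rfl | hS
  · simp
  have hcard : (S.card : ℝ≥0∞) ≠ 0 := mod_cast hS.card_pos.ne'
  refine ENNReal.le_of_forall_pos_le_add fun ε hε _ => ?_
  have hεS : (ε : ℝ≥0∞) / S.card ≠ 0 :=
    (ENNReal.div_pos (mod_cast hε.ne') (ENNReal.natCast_ne_top _)).ne'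
  choose ψ hψ hψ1 hψ0 hmass using fun i => exists_totalMass_singleton_le_add μ i hεS
  calc ∑ i ∈ S, totalMass {i} μ
      ≤ ∑ i ∈ S, (ENNReal.ofReal (∫ᵛ x, ψ i x ∂<•(μ i)) + ε / S.card) :=
        Finset.sum_le_sum fun i _ => hmass i
    _ = ENNReal.ofReal (∑ i ∈ S, ∫ᵛ x, ψ i x ∂<•(μ i)) + ε := by
        rw [Finset.sum_add_distrib, ENNReal.ofReal_sum_of_nonneg fun i _ => hψ0 i,
          Finset.sum_const, nsmul_eq_mul,
          ENNReal.mul_div_cancel hcard (ENNReal.natCast_ne_top _)]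
    _ ≤ ENNReal.ofReal √S.card * totalMass S μ + ε := by
        gcongr
        exact ofReal_sum_integral_le_sqrt_card_mul_totalMass S μ hψ hψ1

end TotalMass

/-! ### Test functions -/

namespace IsTest

variable {φ : ℝ^N → ℝ}

protected theorem pderiv (hφ : IsTest φ) (i : Fin N) : IsTest (pderiv i φ) :=
  ⟨(hφ.1.fderiv_right (m := ∞) (by simp)).clm_apply contDiff_const, hφ.2.fderiv_apply (𝕜 := ℝ) _⟩

theorem continuous (hφ : IsTest φ) : Continuous φ :=
  hφ.1.continuous

theorem differentiable (hφ : IsTest φ) : Differentiable ℝ φ :=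
  hφ.1.differentiable (by simp)

theorem memLp (hφ : IsTest φ) (q : ℝ≥0∞) : MemLp φ q volume :=
  hφ.continuous.memLp_of_hasCompactSupport hφ.2

theorem integrable (hφ : IsTest φ) : Integrable φ volume :=
  hφ.continuous.integrable_of_hasCompactSupport hφ.2

theorem mul_contDiff (hφ : IsTest φ) {v : ℝ^N → ℝ} (hv : ContDiff ℝ ∞ v) :
    IsTest fun x => φ x * v x :=
  ⟨hφ.1.mul hv, hφ.2.mul_right⟩

theorem hasWeakDeriv (hφ : IsTest φ) (i : Fin N) : HasWeakDeriv φ i (pderiv i φ) :=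
  fun _ hη => integral_mul_fderiv_eq_neg_fderiv_mul_of_integrable
    ((hφ.pderiv i).mul_contDiff hη.1).integrable (hφ.mul_contDiff (hη.pderiv i).1).integrable
    (hφ.mul_contDiff hη.1).integrable (fun x _ => hφ.differentiable x)
    (fun x _ => hη.differentiable x)

end IsTest

/-- The family of the classical partial derivatives of a test function, viewed as densities of
signed measures and as functions. -/
noncomputable def testGrad (φ : ℝ^N → ℝ) : Grad N :=
  ⟨fun i => volume.withDensityᵥ (pderiv i φ), fun i => pderiv i φ⟩

theorem integral_testGrad_meas {φ ψ : ℝ^N → ℝ} (hφ : IsTest φ) (hψ : Continuous ψ)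
    (hψs : HasCompactSupport ψ) (i : Fin N) :
    ∫ᵛ x, ψ x ∂<•((testGrad φ).meas i) = ∫ x, pderiv i φ x * ψ x := by
  obtain ⟨C, hC⟩ := hψs.exists_bound_of_continuous hψ
  exact integral_withDensityᵥ (hφ.pderiv i).integrable hψ.measurable hC

theorem IsTest.isBVGrad {φ : ℝ^N → ℝ} (hφ : IsTest φ) (N₁ : ℕ) (p : Fin N → ℝ) :
    IsBVGrad N₁ p φ (testGrad φ) where
  memLp := hφ.memLp _
  meas i _ η hη := by
    rw [integral_testGrad_meas hφ hη.continuous hη.2]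
    exact hφ.hasWeakDeriv i η hη
  func_memLp i _ := (hφ.pderiv i).memLp _
  func i _ := hφ.hasWeakDeriv i

/-- The continuous approximation `t ↦ max (-1) (min 1 (n t))` of the sign function. -/
noncomputable def clampedSign (n : ℕ) (t : ℝ) : ℝ :=
  max (-1) (min 1 (n * t))

theorem continuous_clampedSign (n : ℕ) : Continuous (clampedSign n) := by
  unfold clampedSign
  fun_prop

theorem clampedSign_zero (n : ℕ) : clampedSign n 0 = 0 := by
  simp [clampedSign]

theorem abs_clampedSign_le (n : ℕ) (t : ℝ) : |clampedSign n t| ≤ 1 :=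
  abs_le.2 ⟨le_max_left _ _, max_le (by norm_num) (min_le_left _ _)⟩

theorem tendsto_mul_clampedSign (t : ℝ) :
    Tendsto (fun n => t * clampedSign n t) atTop (𝓝 |t|) := by
  rcases eq_or_ne t 0 with rfl | ht
  · simp
  have hlarge : ∀ᶠ n : ℕ in atTop, 1 ≤ n * |t| :=
    (tendsto_natCast_atTop_atTop.atTop_mul_const (abs_pos.2 ht)).eventually_ge_atTop 1
  refine tendsto_const_nhds.congr' (hlarge.mono fun n hn => ?_)
  rcases ht.lt_or_gt with h | h
  · rw [abs_of_neg h] at hn ⊢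
    have : min 1 (n * t) ≤ -1 := (min_le_right _ _).trans (by linarith)
    simp only [clampedSign, max_eq_left this, mul_neg_one]
  · rw [abs_of_pos h] at hn ⊢
    simp only [clampedSign, min_eq_left hn, max_eq_right (neg_one_lt_zero.trans one_pos).le,
      mul_one]

theorem tendsto_integral_mul_clampedSign {X : Type*} [MeasurableSpace X] {ν : Measure X}
    {g : X → ℝ} (hg : Integrable g ν) :
    Tendsto (fun n => ∫ x, g x * clampedSign n (g x) ∂ν) atTop (𝓝 (∫ x, ‖g x‖ ∂ν)) := by
  refine tendsto_integral_of_dominated_convergence (fun x => ‖g x‖) (fun n => hg.1.mul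
    ((continuous_clampedSign n).comp_aestronglyMeasurable hg.1)) hg.norm
    (fun n => ae_of_all _ fun x => ?_) (ae_of_all _ fun x => tendsto_mul_clampedSign (g x))
  rw [norm_mul]
  exact mul_le_of_le_one_right (norm_nonneg _) (abs_clampedSign_le n _)

theorem IsTest.eLpNorm_pderiv_le_totalMass {φ : ℝ^N → ℝ} (hφ : IsTest φ) (i : Fin N) :
    eLpNorm (pderiv i φ) 1 volume ≤ totalMass {i} (testGrad φ).meas := by
  have hg := hφ.pderiv i
  rw [eLpNorm_one_eq_lintegral_enorm, ← ofReal_integral_norm_eq_lintegral_enorm hg.integrable]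
  refine le_of_tendsto (ENNReal.tendsto_ofReal (tendsto_integral_mul_clampedSign hg.integrable))
    (Eventually.of_forall fun n => ?_)
  have hψ : Continuous fun x => clampedSign n (pderiv i φ x) :=
    (continuous_clampedSign n).comp hg.continuous
  have hψs : HasCompactSupport fun x => clampedSign n (pderiv i φ x) :=
    hg.2.comp_left (clampedSign_zero n)
  have hfield : (fun _ : Fin N => fun x => clampedSign n (pderiv i φ x)) ∈
      UnitFields {i} :=
    ⟨fun _ => ⟨hψ, hψs⟩, fun x => by
      simpa only [Finset.sum_singleton, sq_le_one_iff_abs_le_one] using abs_clampedSign_le n _⟩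
  have h := le_totalMass (testGrad φ).meas hfield
  rwa [Finset.sum_singleton, integral_testGrad_meas hφ hψ hψs] at h

/-! ### Mollification -/

section Jensen

variable {T : Type*} [MeasurableSpace T] {ν : Measure T} [IsProbabilityMeasure ν]
  {F : Type*} [NormedAddCommGroup F] [NormedSpace ℝ F]

theorem enorm_integral_rpow_le {q : ℝ} (hq : 1 ≤ q) {g : T → F} (hg : AEStronglyMeasurable g ν) :
    ‖∫ t, g t ∂ν‖ₑ ^ q ≤ ∫⁻ t, ‖g t‖ₑ ^ q ∂ν := by
  have hq0 : 0 < q := one_pos.trans_le hq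
  have h := eLpNorm'_le_eLpNorm'_of_exponent_le one_pos hq ν hg
  simp only [eLpNorm', ENNReal.rpow_one, one_div_one] at h
  rw [← ENNReal.le_rpow_inv_iff hq0, ← one_div]
  exact (enorm_integral_le_lintegral_enorm g).trans h

theorem integral_sq_le {g : T → ℝ} {C : ℝ} (hg : AEStronglyMeasurable g ν)
    (hC : ∀ t, |g t| ≤ C) : (∫ t, g t ∂ν) ^ 2 ≤ ∫ t, g t ^ 2 ∂ν :=
  (even_two.convexOn_pow (𝕜 := ℝ)).map_integral_le (continuous_pow 2).continuousOn isClosed_univ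
    (ae_of_all _ fun _ => Set.mem_univ _) (Integrable.of_bound hg C (ae_of_all _ hC))
    (Integrable.of_bound (hg.pow 2) (C ^ 2) (ae_of_all _ fun t =>
      (norm_pow (g t) 2).trans_le (pow_le_pow_left₀ (norm_nonneg _) (hC t) 2)))

theorem eLpNorm_integral_le {X : Type*} [MeasurableSpace X] {μ : Measure X} [SFinite μ] {q : ℝ}
    (hq : 1 ≤ q) {f : X → T → F} (hf : StronglyMeasurable (Function.uncurry f)) {C : ℝ≥0∞}
    (hC : ∀ᵐ t ∂ν, eLpNorm (fun x => f x t) (ENNReal.ofReal q) μ ≤ C) :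
    eLpNorm (fun x => ∫ t, f x t ∂ν) (ENNReal.ofReal q) μ ≤ C := by
  have hq0 : 0 < q := one_pos.trans_le hq
  have hpow (g : X → F) : eLpNorm g (ENNReal.ofReal q) μ ≤ C ↔ ∫⁻ x, ‖g x‖ₑ ^ q ∂μ ≤ C ^ q := by
    rw [eLpNorm_eq_lintegral_rpow_enorm_toReal (ENNReal.ofReal_pos.2 hq0).ne'
      ENNReal.ofReal_ne_top, ENNReal.toReal_ofReal hq0.le, one_div, ENNReal.rpow_inv_le_iff hq0]
  rw [hpow]
  calc ∫⁻ x, ‖∫ t, f x t ∂ν‖ₑ ^ q ∂μ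
      ≤ ∫⁻ x, ∫⁻ t, ‖f x t‖ₑ ^ q ∂ν ∂μ := lintegral_mono fun x => enorm_integral_rpow_le hq
        (hf.comp_measurable measurable_prodMk_left).aestronglyMeasurable
    _ = ∫⁻ t, ∫⁻ x, ‖f x t‖ₑ ^ q ∂μ ∂ν :=
        lintegral_lintegral_swap (hf.enorm.pow_const q).aemeasurable
    _ ≤ ∫⁻ _, C ^ q ∂ν := lintegral_mono_ae (hC.mono fun t ht => (hpow _).1 ht)
    _ = C ^ q := by rw [lintegral_const, measure_univ, mul_one]

end Jensen

section Bump

variable {E : Type*} [NormedAddCommGroup E] [NormedSpace ℝ E] [FiniteDimensional ℝ E]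
  [MeasurableSpace E] [BorelSpace E] {μ : Measure E}

theorem tendsto_eLpNorm_comp_sub_right_sub {F : Type*} [NormedAddCommGroup F]
    [μ.IsAddHaarMeasure] {q : ℝ≥0∞} [Fact (1 ≤ q)] (hq : q ≠ ⊤) {f : E → F}
    (hf : MemLp f q μ) :
    Tendsto (fun t => eLpNorm (fun x => f (x - t) - f x) q μ) (𝓝 0) (𝓝 0) := by
  let τ : E → C(E, E) := fun t => ⟨fun x => x - t, by fun_prop⟩
  have hτ : Continuous τ := ContinuousMap.continuous_of_continuous_uncurry τ
    (by simp only [τ, Function.uncurry_def, ContinuousMap.coe_mk]; fun_prop)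
  have hmp (t : E) : MeasurePreserving (τ t) μ μ := measurePreserving_sub_right μ t
  have hcont : Continuous fun t => Lp.compMeasurePreserving (τ t) (hmp t) (hf.toLp f) :=
    continuous_const.compMeasurePreservingLp hτ hmp hq
  refine (tendsto_iff_edist_tendsto_0.1 (hcont.tendsto 0)).congr fun t => ?_
  rw [Lp.toLp_compMeasurePreserving, Lp.toLp_compMeasurePreserving, Lp.edist_toLp_toLp]
  congr 1
  ext x
  simp [τ]

variable {F : Type*} [NormedAddCommGroup F] [NormedSpace ℝ F]

/-- The probability measure with density `b.normed μ`: convolving with `b.normed μ` amounts to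
averaging translates against it. -/
noncomputable def bumpMeasure (b : ContDiffBump (0 : E)) (μ : Measure E) : Measure E :=
  μ.withDensity fun t => ENNReal.ofReal (b.normed μ t)

variable (b : ContDiffBump (0 : E))

theorem integral_bumpMeasure (f : E → F) :
    ∫ t, f t ∂(bumpMeasure b μ) = ∫ t, b.normed μ t • f t ∂μ := by
  rw [bumpMeasure, integral_withDensity_eq_integral_toReal_smul
    b.continuous_normed.measurable.ennreal_ofReal (ae_of_all _ fun _ => ENNReal.ofReal_lt_top)]
  simp only [ENNReal.toReal_ofReal (b.nonneg_normed _)]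

theorem normed_convolution_apply (f : E → F) (x : E) :
    (b.normed μ ⋆[ContinuousLinearMap.lsmul ℝ ℝ, μ] f) x =
      ∫ t, f (x - t) ∂(bumpMeasure b μ) :=
  (integral_bumpMeasure b _).symm

variable [μ.IsAddHaarMeasure]

instance isProbabilityMeasure_bumpMeasure : IsProbabilityMeasure (bumpMeasure b μ) := by
  constructor
  rw [bumpMeasure, withDensity_apply _ MeasurableSet.univ, Measure.restrict_univ,
    ← ofReal_integral_eq_lintegral_ofReal b.integrable_normed (ae_of_all _ b.nonneg_normed),
    b.integral_normed, ENNReal.ofReal_one]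

theorem ae_bumpMeasure_norm_lt : ∀ᵐ t ∂(bumpMeasure b μ), ‖t‖ < b.rOut := by
  rw [bumpMeasure, ae_withDensity_iff b.continuous_normed.measurable.ennreal_ofReal]
  refine ae_of_all _ fun t ht => ?_
  have : t ∈ Function.support (b.normed μ) := fun h => ht (by rw [h, ENNReal.ofReal_zero])
  rwa [b.support_normed_eq, mem_ball_zero_iff] at this

theorem normed_convolution_sub_apply [CompleteSpace F] {f : E → F} (hf : LocallyIntegrable f μ)
    (x : E) :
    (b.normed μ ⋆[ContinuousLinearMap.lsmul ℝ ℝ, μ] f) x - f x =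
      ∫ t, (f (x - t) - f x) ∂(bumpMeasure b μ) := by
  have hint : Integrable (fun t => b.normed μ t • f (x - t)) μ :=
    b.hasCompactSupport_normed.convolutionExists_left (ContinuousLinearMap.lsmul ℝ ℝ)
      b.continuous_normed hf x
  rw [integral_bumpMeasure, convolution_lsmul]
  simp_rw [smul_sub]
  rw [integral_sub hint (b.integrable_normed.smul_const _), b.integral_normed_smul]

theorem eLpNorm_normed_convolution_sub_le [CompleteSpace F] {q : ℝ} (hq : 1 ≤ q) {f : E → F}
    (hf : MemLp f (ENNReal.ofReal q) μ) {C : ℝ≥0∞}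
    (hC : ∀ t, ‖t‖ < b.rOut → eLpNorm (fun x => f (x - t) - f x) (ENNReal.ofReal q) μ ≤ C) :
    eLpNorm (b.normed μ ⋆[ContinuousLinearMap.lsmul ℝ ℝ, μ] f - f) (ENNReal.ofReal q) μ ≤ C := by
  wlog hfm : StronglyMeasurable f generalizing f
  · obtain ⟨g, hg, hfg⟩ := hf.1
    have hconv : b.normed μ ⋆[ContinuousLinearMap.lsmul ℝ ℝ, μ] f =
        b.normed μ ⋆[ContinuousLinearMap.lsmul ℝ ℝ, μ] g := convolution_congr _ .rfl hfg
    rw [hconv, eLpNorm_congr_ae (EventuallyEq.rfl.sub hfg)]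
    refine this (hf.ae_eq hfg) (fun t ht => ?_) hg
    have hfgt := (measurePreserving_sub_right μ t).quasiMeasurePreserving.ae_eq_comp hfg
    exact (eLpNorm_congr_ae (hfgt.symm.sub hfg.symm)).trans_le (hC t ht)
  have hli : LocallyIntegrable f μ := hf.locallyIntegrable (ENNReal.one_le_ofReal.2 hq)
  have heq : b.normed μ ⋆[ContinuousLinearMap.lsmul ℝ ℝ, μ] f - f =
      fun x => ∫ t, (f (x - t) - f x) ∂(bumpMeasure b μ) :=
    funext fun x => normed_convolution_sub_apply b hli x
  rw [heq]
  refine eLpNorm_integral_le hq ?_ ((ae_bumpMeasure_norm_lt b).mono hC)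
  exact (hfm.comp_measurable (measurable_fst.sub measurable_snd)).sub
    (hfm.comp_measurable measurable_fst)

theorem tendsto_eLpNorm_normed_convolution_sub [CompleteSpace F] {ι : Type*} {l : Filter ι}
    {b : ι → ContDiffBump (0 : E)} (hb : Tendsto (fun n => (b n).rOut) l (𝓝 0)) {q : ℝ}
    (hq : 1 ≤ q) {f : E → F} (hf : MemLp f (ENNReal.ofReal q) μ) :
    Tendsto (fun n => eLpNorm ((b n).normed μ ⋆[ContinuousLinearMap.lsmul ℝ ℝ, μ] f - f)
      (ENNReal.ofReal q) μ) l (𝓝 0) := by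
  have : Fact (1 ≤ ENNReal.ofReal q) := ⟨ENNReal.one_le_ofReal.2 hq⟩
  have htrans := tendsto_eLpNorm_comp_sub_right_sub ENNReal.ofReal_ne_top hf
  rw [ENNReal.tendsto_nhds_zero] at htrans ⊢
  intro δ hδ
  obtain ⟨r, hr, hrδ⟩ := Metric.eventually_nhds_iff.1 (htrans δ hδ)
  filter_upwards [hb.eventually_lt_const hr] with n hn
  exact eLpNorm_normed_convolution_sub_le (b n) hq hf fun t ht =>
    hrδ (by rw [dist_zero_right]; exact ht.trans hn)

theorem norm_normed_convolution_le {f : E → F} {C : ℝ} (hC : ∀ x, ‖f x‖ ≤ C) (x : E) :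
    ‖(b.normed μ ⋆[ContinuousLinearMap.lsmul ℝ ℝ, μ] f) x‖ ≤ C := by
  rw [normed_convolution_apply]
  refine (norm_integral_le_of_norm_le_const (ae_of_all _ fun t => hC (x - t))).trans ?_
  rw [probReal_univ, mul_one]

end Bump

theorem integral_mul_convolution {k ζ u : ℝ^N → ℝ} (hk : Continuous k) (hks : HasCompactSupport k)
    (hζ : Continuous ζ) (hζs : HasCompactSupport ζ) (hu : LocallyIntegrable u volume) :
    ∫ x, ζ x * (k ⋆ u) x = ∫ y, u y * ((fun z => k (-z)) ⋆ ζ) y := by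
  have hζ' : Continuous fun x => ζ (-x) := hζ.comp continuous_neg
  have hζs' : HasCompactSupport fun x => ζ (-x) := hζs.comp_homeomorph (Homeomorph.neg (ℝ^N))
  have hun : LocallyIntegrable (fun x => ‖u x‖) volume := fun x =>
    let ⟨s, hs, hsu⟩ := hu x
    ⟨s, hs, hsu.norm⟩
  have hassoc := convolution_assoc (ContinuousLinearMap.lsmul ℝ ℝ) (ContinuousLinearMap.lsmul ℝ ℝ)
    (ContinuousLinearMap.lsmul ℝ ℝ) (ContinuousLinearMap.lsmul ℝ ℝ)
    (fun a b c : ℝ => mul_assoc a b c) (x₀ := (0 : ℝ^N)) hζ'.aestronglyMeasurable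
    hk.aestronglyMeasurable hu.aestronglyMeasurable
    (ae_of_all volume (hζs'.convolutionExists_left _ hζ' hk.locallyIntegrable))
    (ae_of_all volume (hks.norm.convolutionExists_left _ hk.norm hun))
    (hζs'.norm.convolutionExists_left _ hζ'.norm
      (hks.norm.continuous_convolution_left _ hk.norm hun).locallyIntegrable 0)
  simp only [convolution_lsmul, zero_sub, smul_eq_mul] at hassoc
  calc ∫ x, ζ x * (k ⋆ u) x
      = ∫ x, ζ (-x) * ∫ t, k t * u (-x - t) :=
        (integral_neg_eq_self (fun x => ζ x * ∫ t, k t * u (x - t)) volume).symm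
    _ = ∫ y, (∫ t, ζ (-t) * k (y - t)) * u (-y) := hassoc.symm
    _ = ∫ y, (∫ t, ζ (-t) * k (-y - t)) * u y := by
        rw [← integral_neg_eq_self]
        simp only [neg_neg]
    _ = ∫ y, u y * ((fun z => k (-z)) ⋆ ζ) y := by
        refine integral_congr_ae (ae_of_all _ fun y => ?_)
        simp only [convolution_lsmul_swap, smul_eq_mul, mul_comm (u y)]
        rw [← integral_neg_eq_self (fun t => ζ (-t) * k (-y - t))]
        simp only [neg_neg, neg_sub, sub_neg_eq_add, neg_add_eq_sub, mul_comm (k _)]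

section TestKernel

variable {K u : ℝ^N → ℝ}

theorem IsTest.contDiff_convolution (hK : IsTest K) (hu : LocallyIntegrable u volume) :
    ContDiff ℝ ∞ (K ⋆ u) :=
  hK.2.contDiff_convolution_left _ hK.1 hu

theorem IsTest.convolution (hK : IsTest K) (hu : Continuous u) (hus : HasCompactSupport u) :
    IsTest (K ⋆ u) :=
  ⟨hK.contDiff_convolution hu.locallyIntegrable, hK.2.convolution _ hus⟩

theorem IsTest.pderiv_convolution (hK : IsTest K) (hu : LocallyIntegrable u volume) (i : Fin N) :
    pderiv i (K ⋆ u) = pderiv i K ⋆ u := by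
  ext x
  have hderiv := hK.2.hasFDerivAt_convolution_left (ContinuousLinearMap.lsmul ℝ ℝ)
    (hK.1.of_le (by simp)) hu x
  rw [pderiv, hderiv.fderiv, convolution_def, ContinuousLinearMap.integral_apply]
  · rfl
  · exact (hK.2.fderiv (𝕜 := ℝ)).convolutionExists_left _ (hK.1.continuous_fderiv (by simp)) hu x

theorem IsTest.comp_const_sub (hK : IsTest K) (x : ℝ^N) : IsTest fun y => K (x - y) :=
  ⟨hK.1.comp (contDiff_const.sub contDiff_id), hK.2.comp_homeomorph (Homeomorph.subLeft x)⟩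

theorem pderiv_comp_const_sub (hK : Differentiable ℝ K) (i : Fin N) (x y : ℝ^N) :
    pderiv i (fun y => K (x - y)) y = -pderiv i K (x - y) := by
  have hderiv : HasFDerivAt (fun y => K (x - y)) _ y :=
    (hK (x - y)).hasFDerivAt.comp y ((hasFDerivAt_id y).const_sub x)
  rw [pderiv, hderiv.fderiv]
  simp [pderiv]

theorem pderiv_neg_of_even (hK : Differentiable ℝ K) (heven : ∀ x, K (-x) = K x) (i : Fin N)
    (x : ℝ^N) : pderiv i K (-x) = -pderiv i K x := by
  have h := pderiv_comp_const_sub hK i 0 x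
  simp only [zero_sub, heven] at h
  exact neg_eq_iff_eq_neg.1 h.symm

theorem HasWeakDeriv.pderiv_convolution {g : ℝ^N → ℝ} {i : Fin N} (hK : IsTest K)
    (hu : LocallyIntegrable u volume) (h : HasWeakDeriv u i g) :
    pderiv i (K ⋆ u) = K ⋆ g := by
  ext x
  have hx := h _ (hK.comp_const_sub x)
  simp_rw [pderiv_comp_const_sub hK.differentiable, mul_neg, integral_neg, neg_inj] at hx
  simp_rw [hK.pderiv_convolution hu, convolution_lsmul_swap, smul_eq_mul, mul_comm _ (u _),
    mul_comm _ (g _)]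
  exact hx

theorem HasMeasureDeriv.integral_mul_pderiv_convolution {ζ : ℝ^N → ℝ} {i : Fin N}
    {μ : SignedMeasure (ℝ^N)} (hK : IsTest K) (heven : ∀ x, K (-x) = K x)
    (hu : LocallyIntegrable u volume) (h : HasMeasureDeriv u i μ) (hζ : Continuous ζ)
    (hζs : HasCompactSupport ζ) :
    ∫ x, ζ x * pderiv i (K ⋆ u) x = ∫ᵛ x, (K ⋆ ζ) x ∂<•μ := by
  have hodd : (fun z => pderiv i K (-z)) ⋆ ζ = -pderiv i (K ⋆ ζ) := by
    rw [hK.pderiv_convolution hζ.locallyIntegrable]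
    ext x
    simp only [pderiv_neg_of_even hK.differentiable heven, convolution_lsmul, neg_smul,
      integral_neg, Pi.neg_apply]
  rw [hK.pderiv_convolution hu, integral_mul_convolution (hK.pderiv i).continuous
    (hK.pderiv i).2 hζ hζs hu, hodd]
  simp only [Pi.neg_apply, mul_neg, integral_neg]
  rw [h _ (hK.convolution hζ hζs), neg_neg]

theorem isTest_normed (b : ContDiffBump (0 : ℝ^N)) : IsTest (b.normed volume) :=
  ⟨b.contDiff_normed, b.hasCompactSupport_normed⟩

theorem normed_convolution_mem_unitFields (b : ContDiffBump (0 : ℝ^N)) {S : Finset (Fin N)}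
    {ψ : Fin N → ℝ^N → ℝ} (hψ : ψ ∈ UnitFields S) :
    (fun i => b.normed volume ⋆ ψ i) ∈ UnitFields S := by
  refine ⟨fun i => ?_, fun x => ?_⟩
  · have h := (isTest_normed b).convolution (hψ.1 i).1 (hψ.1 i).2
    exact ⟨h.continuous, h.2⟩
  have hmeas (i : Fin N) : AEStronglyMeasurable (fun t => ψ i (x - t)) (bumpMeasure b volume) :=
    ((hψ.1 i).1.comp (continuous_const.sub continuous_id)).aestronglyMeasurable
  calc ∑ i ∈ S, (b.normed volume ⋆ ψ i) x ^ 2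
      ≤ ∑ i ∈ S, ∫ t, ψ i (x - t) ^ 2 ∂(bumpMeasure b volume) := Finset.sum_le_sum fun i hi => by
        rw [normed_convolution_apply]
        exact integral_sq_le (hmeas i) fun t => abs_le_one_of_mem_unitFields hψ hi _
    _ = ∫ t, ∑ i ∈ S, ψ i (x - t) ^ 2 ∂(bumpMeasure b volume) :=
        (integral_finsetSum _ fun i hi => Integrable.of_bound ((hmeas i).pow 2) 1
          (ae_of_all _ fun t => (norm_pow (ψ i (x - t)) 2).trans_le
            (pow_le_one₀ (norm_nonneg _) (abs_le_one_of_mem_unitFields hψ hi _)))).symm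
    _ ≤ ∫ _, 1 ∂(bumpMeasure b volume) := integral_mono_of_nonneg
        (ae_of_all _ fun t => Finset.sum_nonneg fun i _ => sq_nonneg _) (integrable_const 1)
        (ae_of_all _ fun t => hψ.2 (x - t))
    _ = 1 := by rw [integral_const, probReal_univ, one_smul]

end TestKernel

/-! ### Anisotropic cutoff functions -/

theorem eLpNorm_comp_linearMap {E F : Type*} [NormedAddCommGroup E] [NormedSpace ℝ E]
    [FiniteDimensional ℝ E] [MeasurableSpace E] [BorelSpace E] {μ : Measure E}
    [μ.IsAddHaarMeasure] [NormedAddCommGroup F] {A : E →ₗ[ℝ] E} (hA : LinearMap.det A ≠ 0)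
    {g : E → F} (hg : Continuous g) {q : ℝ≥0∞} (hq : q ≠ ⊤) :
    eLpNorm (g ∘ A) q μ =
      ENNReal.ofReal |(LinearMap.det A)⁻¹| ^ (1 / q).toReal * eLpNorm g q μ := by
  have hA' : Continuous A := A.continuous_of_finiteDimensional
  rw [← smul_eq_mul, ← eLpNorm_smul_measure_of_ne_top hq,
    ← Measure.map_linearMap_addHaar_eq_smul_addHaar μ hA,
    eLpNorm_map_measure hg.aestronglyMeasurable hA'.aemeasurable]

/-- The anisotropic dilation `x ↦ (s_i x_i)_i`. -/
noncomputable def dilation (s : Fin N → ℝ) : ℝ^N →ₗ[ℝ] ℝ^N :=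
  Matrix.toEuclideanLin (Matrix.diagonal s)

theorem dilation_apply (s : Fin N → ℝ) (x : ℝ^N) (i : Fin N) : dilation s x i = s i * x i := by
  simp [dilation, Matrix.mulVec_diagonal]

theorem det_dilation (s : Fin N → ℝ) : LinearMap.det (dilation s) = ∏ i, s i := by
  rw [dilation, LinearMap.det_toLpLin, Matrix.det_diagonal]

theorem dilation_single (s : Fin N → ℝ) (i : Fin N) :
    dilation s (EuclideanSpace.single i 1) = s i • EuclideanSpace.single i 1 := by
  ext j
  rcases eq_or_ne j i with rfl | hj
  · simp [dilation_apply]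
  · simp [dilation_apply, hj]

theorem norm_dilation_le {s : Fin N → ℝ} {m : ℝ} (hm : 0 ≤ m) (hs : ∀ i, |s i| ≤ m) (x : ℝ^N) :
    ‖dilation s x‖ ≤ m * ‖x‖ := by
  rw [← sq_le_sq₀ (norm_nonneg _) (by positivity), mul_pow, EuclideanSpace.norm_sq_eq,
    EuclideanSpace.norm_sq_eq, Finset.mul_sum]
  refine Finset.sum_le_sum fun i _ => ?_
  rw [dilation_apply, norm_mul, mul_pow]
  gcongr
  exact hs i

theorem IsTest.comp_dilation {θ : ℝ^N → ℝ} (hθ : IsTest θ) {s : Fin N → ℝ}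
    (hs : ∏ i, s i ≠ 0) : IsTest (θ ∘ dilation s) := by
  refine ⟨hθ.1.comp (dilation s).toContinuousLinearMap.contDiff, hθ.2.comp_isClosedEmbedding
    (LinearMap.isClosedEmbedding_of_injective (f := dilation s) ?_)⟩
  exact (LinearMap.equivOfDetNeZero (dilation s) (by rwa [det_dilation])).ker

theorem pderiv_comp_dilation {θ : ℝ^N → ℝ} (hθ : Differentiable ℝ θ) (s : Fin N → ℝ) (i : Fin N) :
    pderiv i (θ ∘ dilation s) = s i • (pderiv i θ ∘ dilation s) := by
  ext x
  have hderiv : HasFDerivAt (θ ∘ dilation s) _ x :=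
    (hθ (dilation s x)).hasFDerivAt.comp x (dilation s).toContinuousLinearMap.hasFDerivAt
  rw [pderiv, hderiv.fderiv]
  simp [pderiv, dilation_single]

theorem eLpNorm_pderiv_comp_dilation {θ : ℝ^N → ℝ} (hθ : IsTest θ) {s : Fin N → ℝ}
    (hs : ∏ i, s i ≠ 0) (i : Fin N) {q : ℝ≥0∞} (hq : q ≠ ⊤) :
    eLpNorm (pderiv i (θ ∘ dilation s)) q volume =
      ‖s i‖ₑ *
        (ENNReal.ofReal |(∏ j, s j)⁻¹| ^ (1 / q).toReal * eLpNorm (pderiv i θ) q volume) := by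
  rw [pderiv_comp_dilation hθ.differentiable, eLpNorm_const_smul,
    eLpNorm_comp_linearMap (by rwa [det_dilation]) (hθ.pderiv i).continuous hq, det_dilation]

/-- Cutoff functions adapted to the exponents `a`: test functions with values in `[0, 1]`, equal
to `1` on larger and larger balls, whose partial derivatives `∂_i` stay bounded in `L^{1/a_i}`. By
Hölder's inequality, multiplication by `∂_i η_n` is then bounded from `L^q` to `L^r` as soon as
`1/r = a_i + 1/q`. -/
structure IsAnisotropicCutoff (a : Fin N → ℝ) (η : ℕ → ℝ^N → ℝ) : Prop where
  isTest : ∀ n, IsTest (η n)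
  nonneg : ∀ n x, 0 ≤ η n x
  le_one : ∀ n x, η n x ≤ 1
  eventually_eq_one : ∀ R : ℝ, ∀ᶠ n in atTop, ∀ x, ‖x‖ < R → η n x = 1
  exists_bound : ∀ i, ∃ B : ℝ≥0∞, B ≠ ⊤ ∧
    ∀ n, eLpNorm (pderiv i (η n)) (ENNReal.ofReal (a i)⁻¹) volume ≤ B

theorem eventually_norm_dilation_le_one {a : Fin N → ℝ} (ha : ∀ i, 0 < a i) (R : ℝ) :
    ∀ᶠ t : ℝ in atTop, ∀ x : ℝ^N, ‖x‖ < R → ‖dilation (fun i => t ^ (-a i)) x‖ ≤ 1 := by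
  have hsmall : ∀ i, ∀ᶠ t : ℝ in atTop, |t ^ (-a i)| ≤ (|R| + 1)⁻¹ := fun i => by
    have hlim := (tendsto_rpow_neg_atTop (ha i)).abs
    rw [abs_zero] at hlim
    exact hlim.eventually_le_const (by positivity)
  filter_upwards [eventually_all.2 hsmall] with t ht x hx
  calc ‖dilation (fun i => t ^ (-a i)) x‖
      ≤ (|R| + 1)⁻¹ * ‖x‖ := norm_dilation_le (by positivity) ht x
    _ ≤ (|R| + 1)⁻¹ * (|R| + 1) := by gcongr; linarith [le_abs_self R]
    _ = 1 := inv_mul_cancel₀ (by positivity)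

theorem eLpNorm_pderiv_comp_dilation_rpow {a : Fin N → ℝ} (hsum : ∑ i, a i = 1) {θ : ℝ^N → ℝ}
    (hθ : IsTest θ) {t : ℝ} (ht : 0 < t) {i : Fin N} (hai : 0 < a i) :
    eLpNorm (pderiv i (θ ∘ dilation fun i => t ^ (-a i))) (ENNReal.ofReal (a i)⁻¹) volume =
      eLpNorm (pderiv i θ) (ENNReal.ofReal (a i)⁻¹) volume := by
  have hprod : ∏ j, t ^ (-a j) = t⁻¹ := by
    rw [← Real.rpow_sum_of_pos ht, Finset.sum_neg_distrib, hsum, Real.rpow_neg_one]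
  have hexp : (1 / ENNReal.ofReal (a i)⁻¹).toReal = a i := by
    rw [one_div, ENNReal.toReal_inv, ENNReal.toReal_ofReal (inv_pos.2 hai).le, inv_inv]
  rw [eLpNorm_pderiv_comp_dilation hθ (by rw [hprod]; exact (inv_pos.2 ht).ne') i
    ENNReal.ofReal_ne_top, hprod, inv_inv, hexp, abs_of_pos ht, ← mul_assoc,
    ENNReal.ofReal_rpow_of_pos ht, ← ofReal_norm, Real.norm_of_nonneg (Real.rpow_nonneg ht.le _),
    ← ENNReal.ofReal_mul (Real.rpow_nonneg ht.le _), ← Real.rpow_add ht, neg_add_cancel,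
    Real.rpow_zero, ENNReal.ofReal_one, one_mul]

theorem exists_isAnisotropicCutoff {a : Fin N → ℝ} (ha : ∀ i, 0 < a i) (hsum : ∑ i, a i = 1) :
    ∃ η : ℕ → ℝ^N → ℝ, IsAnisotropicCutoff a η := by
  let θ : ContDiffBump (0 : ℝ^N) := ⟨1, 2, one_pos, one_lt_two⟩
  have hθ : IsTest θ := ⟨θ.contDiff, θ.hasCompactSupport⟩
  have ht (n : ℕ) : (0 : ℝ) < n + 1 := by positivity
  refine ⟨fun n => θ ∘ dilation fun i => (n + 1 : ℝ) ^ (-a i), fun n => hθ.comp_dilation ?_,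
    fun n x => θ.nonneg, fun n x => θ.le_one, fun R => ?_, fun i =>
    ⟨_, ((hθ.pderiv i).memLp _).eLpNorm_ne_top, fun n =>
      (eLpNorm_pderiv_comp_dilation_rpow hsum hθ (ht n) (ha i)).le⟩⟩
  · exact (Finset.prod_pos fun i _ => Real.rpow_pos_of_pos (ht n) _).ne'
  · have hlim : Tendsto (fun n : ℕ => (n + 1 : ℝ)) atTop atTop :=
      tendsto_natCast_atTop_atTop.atTop_add tendsto_const_nhds
    filter_upwards [hlim.eventually (eventually_norm_dilation_le_one ha R)] with n hn x hx
    exact θ.one_of_mem_closedBall (mem_closedBall_zero_iff.2 (hn x hx))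

namespace IsAnisotropicCutoff

variable {a : Fin N → ℝ} {η : ℕ → ℝ^N → ℝ}

theorem abs_le_one (h : IsAnisotropicCutoff a η) (n : ℕ) (x : ℝ^N) : |η n x| ≤ 1 :=
  abs_le.2 ⟨neg_one_lt_zero.le.trans (h.nonneg n x), h.le_one n x⟩

theorem eventually_apply_eq_one (h : IsAnisotropicCutoff a η) (x : ℝ^N) :
    ∀ᶠ n in atTop, η n x = 1 :=
  (h.eventually_eq_one (‖x‖ + 1)).mono fun _ hn => hn x (lt_add_one _)

theorem eventually_pderiv_eq_zero (h : IsAnisotropicCutoff a η) (R : ℝ) (i : Fin N) :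
    ∀ᶠ n in atTop, ∀ x, ‖x‖ < R → pderiv i (η n) x = 0 := by
  filter_upwards [h.eventually_eq_one R] with n hn x hx
  have hloc : η n =ᶠ[𝓝 x] fun _ => (1 : ℝ) := by
    filter_upwards [Metric.isOpen_ball.mem_nhds (mem_ball_zero_iff.2 hx)] with y hy
    exact hn y (mem_ball_zero_iff.1 hy)
  rw [pderiv, hloc.fderiv_eq, fderiv_fun_const]
  rfl

end IsAnisotropicCutoff

/-! ### Approximation by test functions -/

section LpProducts

variable {X : Type*} [MeasurableSpace X] {μ : Measure X} {f g : X → ℝ}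

theorem eLpNorm_mul_le_of_abs_le_one {q : ℝ≥0∞} (hf : ∀ x, |f x| ≤ 1) :
    eLpNorm (f * g) q μ ≤ eLpNorm g q μ :=
  eLpNorm_mono fun x => (norm_mul (f x) (g x)).trans_le
    (mul_le_of_le_one_left (norm_nonneg _) (hf x))

theorem eLpNorm_mul_le_of_holder {a q r : ℝ} (ha : 0 < a) (hq : 0 < q) (hr : 1 / r = a + 1 / q)
    (hf : AEStronglyMeasurable f μ) (hg : AEStronglyMeasurable g μ) :
    eLpNorm (f * g) (ENNReal.ofReal r) μ ≤
      eLpNorm f (ENNReal.ofReal a⁻¹) μ * eLpNorm g (ENNReal.ofReal q) μ := by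
  have hholder : Real.HolderTriple a⁻¹ q r :=
    ⟨by rw [inv_inv, ← one_div q, ← one_div r, hr], inv_pos.2 ha, hq⟩
  have := hholder.ennrealOfReal
  exact eLpNorm_smul_le_mul_eLpNorm (φ := f) (f := g) hg hf

theorem tendsto_eLpNorm_mul_of_eventually_eq_zero {q : ℝ≥0∞} (hq0 : q ≠ 0) (hq : q ≠ ⊤)
    (hf : MemLp f q μ) {θ : ℕ → X → ℝ} (hm : ∀ n, AEStronglyMeasurable (θ n) μ)
    (h1 : ∀ n x, |θ n x| ≤ 1) (h0 : ∀ x, ∀ᶠ n in atTop, θ n x = 0) :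
    Tendsto (fun n => eLpNorm (θ n * f) q μ) atTop (𝓝 0) := by
  have hq' : 0 < q.toReal := ENNReal.toReal_pos hq0 hq
  have hlim : Tendsto (fun n => ∫⁻ x, ‖(θ n * f) x‖ₑ ^ q.toReal ∂μ) atTop (𝓝 (∫⁻ _, 0 ∂μ)) := by
    refine tendsto_lintegral_of_dominated_convergence' (fun x => ‖f x‖ₑ ^ q.toReal)
      (fun n => ((hm n).mul hf.1).enorm.pow_const _) (fun n => ae_of_all _ fun x => ?_)
      (lintegral_rpow_enorm_lt_top_of_eLpNorm_lt_top hq0 hq hf.2).ne (ae_of_all _ fun x => ?_)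
    · refine ENNReal.rpow_le_rpow (enorm_le_iff_norm_le.2 ?_) hq'.le
      rw [Pi.mul_apply, norm_mul]
      exact mul_le_of_le_one_left (norm_nonneg _) (h1 n x)
    · refine tendsto_const_nhds.congr' ((h0 x).mono fun n hn => ?_)
      simp [hn, hq']
  have hpow := (ENNReal.continuous_rpow_const (y := 1 / q.toReal)).tendsto (∫⁻ _, 0 ∂μ) |>.comp hlim
  rw [lintegral_zero, ENNReal.zero_rpow_of_pos (by positivity)] at hpow
  exact hpow.congr fun n => (eLpNorm_eq_lintegral_rpow_enorm_toReal hq0 hq).symm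

theorem tendsto_eLpNorm_mul_of_holder {a q r : ℝ} (ha : 0 < a) (hq : 0 < q) (hr : 1 / r = a + 1 / q)
    (hr1 : 1 ≤ r) {B : ℝ≥0∞} (hB : B ≠ ⊤) {v : X → ℝ} (hv : MemLp v (ENNReal.ofReal q) μ)
    {g w : ℕ → X → ℝ} (hg : ∀ n, StronglyMeasurable (g n))
    (hgB : ∀ n, eLpNorm (g n) (ENNReal.ofReal a⁻¹) μ ≤ B)
    (hg0 : ∀ x, ∀ᶠ n in atTop, g n x = 0) (hw : ∀ n, AEStronglyMeasurable (w n) μ)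
    (hwv : Tendsto (fun n => eLpNorm (w n - v) (ENNReal.ofReal q) μ) atTop (𝓝 0)) :
    Tendsto (fun n => eLpNorm (g n * w n) (ENNReal.ofReal r) μ) atTop (𝓝 0) := by
  let θ : ℕ → X → ℝ := fun n => (Function.support (g n)).indicator 1
  have hθ (n : ℕ) : StronglyMeasurable (θ n) :=
    stronglyMeasurable_one.indicator (measurableSet_support (hg n).measurable)
  have hθv : Tendsto (fun n => eLpNorm (θ n * v) (ENNReal.ofReal q) μ) atTop (𝓝 0) := by
    refine tendsto_eLpNorm_mul_of_eventually_eq_zero (ENNReal.ofReal_pos.2 hq).ne'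
      ENNReal.ofReal_ne_top hv (fun n => (hθ n).aestronglyMeasurable) (fun n x => ?_)
      (fun x => (hg0 x).mono fun n hn => by simp [θ, hn])
    by_cases hx : x ∈ Function.support (g n) <;> simp [θ, hx]
  have hsplit (n : ℕ) : g n * w n = g n * (w n - v) + g n * (θ n * v) := by
    ext x
    by_cases hx : g n x = 0
    · simp [hx]
    · simp only [θ, Pi.add_apply, Pi.mul_apply, Pi.sub_apply, Pi.one_apply,
        Set.indicator_of_mem (Function.mem_support.2 hx)]
      ring
  have hlim := (ENNReal.Tendsto.const_mul hwv (Or.inr hB)).add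
    (ENNReal.Tendsto.const_mul hθv (Or.inr hB))
  rw [mul_zero, add_zero] at hlim
  refine tendsto_of_tendsto_of_tendsto_of_le_of_le tendsto_const_nhds hlim (fun _ => zero_le)
    fun n => ?_
  have hgm := (hg n).aestronglyMeasurable (μ := μ)
  have hdiff := (hw n).sub hv.1
  have htail := (hθ n).aestronglyMeasurable.mul hv.1
  calc eLpNorm (g n * w n) (ENNReal.ofReal r) μ
      ≤ eLpNorm (g n * (w n - v)) (ENNReal.ofReal r) μ +
          eLpNorm (g n * (θ n * v)) (ENNReal.ofReal r) μ := by
        rw [hsplit n]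
        exact eLpNorm_add_le (hgm.mul hdiff) (hgm.mul htail) (ENNReal.one_le_ofReal.2 hr1)
    _ ≤ B * eLpNorm (w n - v) (ENNReal.ofReal q) μ + B * eLpNorm (θ n * v) (ENNReal.ofReal q) μ :=
        add_le_add ((eLpNorm_mul_le_of_holder ha hq hr hgm hdiff).trans (by gcongr; exact hgB n))
          ((eLpNorm_mul_le_of_holder ha hq hr hgm htail).trans (by gcongr; exact hgB n))

end LpProducts

/-- The truncated mollification `η (b ⋆ u)` of `u`, a test function when `η` is one. -/
noncomputable def cutoffMoll (η : ℝ^N → ℝ) (b : ContDiffBump (0 : ℝ^N)) (u : ℝ^N → ℝ) :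
    ℝ^N → ℝ :=
  η * (b.normed volume ⋆ u)

section CutoffMoll

variable {η u : ℝ^N → ℝ} (b : ContDiffBump (0 : ℝ^N)) {i : Fin N}

theorem pderiv_mul {φ v : ℝ^N → ℝ} (hφ : Differentiable ℝ φ) (hv : Differentiable ℝ v)
    (i : Fin N) : pderiv i (φ * v) = φ * pderiv i v + pderiv i φ * v := by
  ext x
  rw [pderiv, fderiv_mul (hφ x) (hv x)]
  simp [pderiv, mul_comm]

theorem contDiff_normed_convolution (hu : LocallyIntegrable u volume) :
    ContDiff ℝ ∞ (b.normed volume ⋆ u) :=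
  (isTest_normed b).contDiff_convolution hu

theorem IsTest.cutoffMoll (hη : IsTest η) (hu : LocallyIntegrable u volume) :
    IsTest (cutoffMoll η b u) :=
  hη.mul_contDiff (contDiff_normed_convolution b hu)

theorem pderiv_cutoffMoll (hη : IsTest η) (hu : LocallyIntegrable u volume) (i : Fin N) :
    pderiv i (cutoffMoll η b u) =
      η * pderiv i (b.normed volume ⋆ u) + pderiv i η * (b.normed volume ⋆ u) :=
  pderiv_mul hη.differentiable ((contDiff_normed_convolution b hu).differentiable (by simp)) i

theorem integral_testGrad_cutoffMoll {μ : SignedMeasure (ℝ^N)} (hη : IsTest η)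
    (hu : LocallyIntegrable u volume) (hμ : HasMeasureDeriv u i μ) {ζ : ℝ^N → ℝ}
    (hζ : Continuous ζ) (hζs : HasCompactSupport ζ) :
    ∫ᵛ x, ζ x ∂<•((testGrad (cutoffMoll η b u)).meas i) =
      ∫ᵛ x, (b.normed volume ⋆ (η * ζ)) x ∂<•μ +
        ∫ x, ζ x * (pderiv i η * (b.normed volume ⋆ u)) x := by
  have hv := contDiff_normed_convolution b hu
  have hηζ : Continuous (η * ζ) := hη.continuous.mul hζ
  have hv' : Continuous (pderiv i (b.normed volume ⋆ u)) :=
    (hv.continuous_fderiv (by simp)).clm_apply continuous_const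
  rw [integral_testGrad_meas (hη.cutoffMoll b hu) hζ hζs, pderiv_cutoffMoll b hη hu,
    ← hμ.integral_mul_pderiv_convolution (isTest_normed b) b.normed_neg hu hηζ hζs.mul_left,
    ← integral_add]
  · refine integral_congr_ae (ae_of_all _ fun x => ?_)
    simp only [Pi.add_apply, Pi.mul_apply]
    ring
  · exact (hηζ.mul hv').integrable_of_hasCompactSupport hζs.mul_left.mul_right
  · exact (hζ.mul ((hη.pderiv i).continuous.mul hv.continuous)).integrable_of_hasCompactSupport
      hζs.mul_right

theorem ofReal_sum_integral_mul_le {X : Type*} [MeasurableSpace X] {ν : Measure X} {ι : Type*}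
    (S : Finset ι) {ψ g : ι → X → ℝ} (hψ : ∀ i ∈ S, ∀ x, |ψ i x| ≤ 1) :
    ENNReal.ofReal (∑ i ∈ S, ∫ x, ψ i x * g i x ∂ν) ≤ ∑ i ∈ S, eLpNorm (g i) 1 ν := by
  refine (Finset.le_sum_of_subadditive ENNReal.ofReal ENNReal.ofReal_zero.le
    (fun _ _ => ENNReal.ofReal_add_le) S _).trans (Finset.sum_le_sum fun i hi => ?_)
  calc ENNReal.ofReal (∫ x, ψ i x * g i x ∂ν) ≤ ‖∫ x, ψ i x * g i x ∂ν‖ₑ :=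
        Real.ofReal_le_enorm _
    _ ≤ ∫⁻ x, ‖ψ i x * g i x‖ₑ ∂ν := enorm_integral_le_lintegral_enorm _
    _ = eLpNorm (ψ i * g i) 1 ν := eLpNorm_one_eq_lintegral_enorm.symm
    _ ≤ eLpNorm (g i) 1 ν := eLpNorm_mul_le_of_abs_le_one (hψ i hi)

theorem totalMass_testGrad_cutoffMoll_le (hη : IsTest η) (hη1 : ∀ x, |η x| ≤ 1)
    (hu : LocallyIntegrable u volume) {S : Finset (Fin N)} {μ : Fin N → SignedMeasure (ℝ^N)}
    (hμ : ∀ i ∈ S, HasMeasureDeriv u i (μ i)) :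
    totalMass S (testGrad (cutoffMoll η b u)).meas ≤
      totalMass S μ + ∑ i ∈ S, eLpNorm (pderiv i η * (b.normed volume ⋆ u)) 1 volume := by
  refine totalMass_le fun ψ hψ => ?_
  have hηψ : (fun i => η * ψ i) ∈ UnitFields S := by
    refine ⟨fun i => ⟨hη.continuous.mul (hψ.1 i).1, (hψ.1 i).2.mul_left⟩, fun x =>
      (Finset.sum_le_sum fun i _ => ?_).trans (hψ.2 x)⟩
    simp only [Pi.mul_apply, mul_pow]
    exact mul_le_of_le_one_left (sq_nonneg _) ((sq_le_one_iff_abs_le_one _).2 (hη1 x))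
  rw [Finset.sum_congr rfl fun i hi =>
    integral_testGrad_cutoffMoll b hη hu (hμ i hi) (hψ.1 i).1 (hψ.1 i).2, Finset.sum_add_distrib]
  exact ENNReal.ofReal_add_le.trans (add_le_add
    (le_totalMass μ (normed_convolution_mem_unitFields b hηψ))
    (ofReal_sum_integral_mul_le S fun i hi => abs_le_one_of_mem_unitFields hψ hi))

end CutoffMoll

namespace IsAnisotropicCutoff

variable {a : Fin N → ℝ} {η : ℕ → ℝ^N → ℝ} {b : ℕ → ContDiffBump (0 : ℝ^N)} {i : Fin N}
  {u : ℝ^N → ℝ}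

theorem tendsto_eLpNorm_cutoffMoll_sub (h : IsAnisotropicCutoff a η)
    (hb : Tendsto (fun n => (b n).rOut) atTop (𝓝 0)) {r : ℝ} (hr : 1 ≤ r)
    (hu : MemLp u (ENNReal.ofReal r) volume) :
    Tendsto (fun n => eLpNorm (cutoffMoll (η n) (b n) u - u) (ENNReal.ofReal r) volume) atTop
      (𝓝 0) := by
  have hr1 : 1 ≤ ENNReal.ofReal r := ENNReal.one_le_ofReal.2 hr
  have hηm (n : ℕ) : AEStronglyMeasurable (η n) volume :=
    (h.isTest n).continuous.aestronglyMeasurable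
  have htail :
      Tendsto (fun n => eLpNorm ((η n - 1) * u) (ENNReal.ofReal r) volume) atTop (𝓝 0) := by
    refine tendsto_eLpNorm_mul_of_eventually_eq_zero (one_pos.trans_le hr1).ne'
      ENNReal.ofReal_ne_top hu (fun n => (hηm n).sub aestronglyMeasurable_one) (fun n x => ?_)
      (fun x => (h.eventually_apply_eq_one x).mono fun n hn => sub_eq_zero.2 hn)
    rw [Pi.sub_apply, Pi.one_apply, abs_le]
    constructor <;> linarith [h.nonneg n x, h.le_one n x]
  have hlim := (tendsto_eLpNorm_normed_convolution_sub hb hr hu).add htail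
  rw [add_zero] at hlim
  refine tendsto_of_tendsto_of_tendsto_of_le_of_le tendsto_const_nhds hlim (fun _ => zero_le)
    fun n => ?_
  have hv := contDiff_normed_convolution (b n) (hu.locallyIntegrable hr1)
  have hsplit : cutoffMoll (η n) (b n) u - u =
      η n * ((b n).normed volume ⋆ u - u) + (η n - 1) * u := by
    rw [cutoffMoll]
    ring
  rw [hsplit]
  exact (eLpNorm_add_le ((hηm n).mul (hv.continuous.aestronglyMeasurable.sub hu.1))
    (((hηm n).sub aestronglyMeasurable_one).mul hu.1) hr1).trans
    (add_le_add_left (eLpNorm_mul_le_of_abs_le_one (h.abs_le_one n)) _)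

theorem tendsto_eLpNorm_pderiv_mul (h : IsAnisotropicCutoff a η)
    (hb : Tendsto (fun n => (b n).rOut) atTop (𝓝 0)) {q r : ℝ} (hai : 0 < a i) (hq : 1 ≤ q)
    (hr : 1 ≤ r) (hrq : 1 / r = a i + 1 / q) (hu : MemLp u (ENNReal.ofReal q) volume) :
    Tendsto (fun n => eLpNorm (pderiv i (η n) * ((b n).normed volume ⋆ u)) (ENNReal.ofReal r)
      volume) atTop (𝓝 0) := by
  obtain ⟨B, hB, hηB⟩ := h.exists_bound i
  exact tendsto_eLpNorm_mul_of_holder hai (one_pos.trans_le hq) hrq hr hB hu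
    (fun n => ((h.isTest n).pderiv i).continuous.stronglyMeasurable) hηB
    (fun x => (h.eventually_pderiv_eq_zero (‖x‖ + 1) i).mono fun _ hn => hn x (lt_add_one _))
    (fun n => (contDiff_normed_convolution (b n) (hu.locallyIntegrable
      (ENNReal.one_le_ofReal.2 hq))).continuous.aestronglyMeasurable)
    (tendsto_eLpNorm_normed_convolution_sub hb hq hu)

theorem tendsto_eLpNorm_pderiv_cutoffMoll_sub (h : IsAnisotropicCutoff a η)
    (hb : Tendsto (fun n => (b n).rOut) atTop (𝓝 0)) {q r : ℝ} (hai : 0 < a i) (hq : 1 ≤ q)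
    (hr : 1 ≤ r) (hrq : 1 / r = a i + 1 / q) (hu : MemLp u (ENNReal.ofReal q) volume)
    {g : ℝ^N → ℝ} (hg : MemLp g (ENNReal.ofReal r) volume) (hug : HasWeakDeriv u i g) :
    Tendsto (fun n => eLpNorm (pderiv i (cutoffMoll (η n) (b n) u) - g) (ENNReal.ofReal r) volume)
      atTop (𝓝 0) := by
  have huL := hu.locallyIntegrable (ENNReal.one_le_ofReal.2 hq)
  have hgL := hg.locallyIntegrable (ENNReal.one_le_ofReal.2 hr)
  have hlim := (h.tendsto_eLpNorm_cutoffMoll_sub hb hr hg).add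
    (h.tendsto_eLpNorm_pderiv_mul hb hai hq hr hrq hu)
  rw [add_zero] at hlim
  refine tendsto_of_tendsto_of_tendsto_of_le_of_le tendsto_const_nhds hlim (fun _ => zero_le)
    fun n => ?_
  have hsplit : pderiv i (cutoffMoll (η n) (b n) u) - g =
      (cutoffMoll (η n) (b n) g - g) + pderiv i (η n) * ((b n).normed volume ⋆ u) := by
    rw [pderiv_cutoffMoll _ (h.isTest n) huL, hug.pderiv_convolution (isTest_normed _) huL,
      cutoffMoll]
    ring
  rw [hsplit]
  exact eLpNorm_add_le
    (((h.isTest n).cutoffMoll (b n) hgL).continuous.aestronglyMeasurable.sub hg.1)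
    (((h.isTest n).pderiv i).continuous.mul
      (contDiff_normed_convolution (b n) huL).continuous).aestronglyMeasurable
    (ENNReal.one_le_ofReal.2 hr)

theorem vague_testGrad_cutoffMoll (h : IsAnisotropicCutoff a η)
    (hb : Tendsto (fun n => (b n).rOut) atTop (𝓝 0)) (hu : LocallyIntegrable u volume)
    {μ : SignedMeasure (ℝ^N)} (hμ : HasMeasureDeriv u i μ) :
    Vague (fun n => (testGrad (cutoffMoll (η n) (b n) u)).meas i) μ := by
  intro ζ hζ hζs
  obtain ⟨C, hC⟩ := hζs.exists_bound_of_continuous hζ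
  obtain ⟨R, hR⟩ := hζs.isCompact.isBounded.exists_norm_le
  have hlim : Tendsto (fun n => ∫ᵛ x, ((b n).normed volume ⋆ ζ) x ∂<•μ) atTop
      (𝓝 (∫ᵛ x, ζ x ∂<•μ)) :=
    VectorMeasure.tendsto_integral_filter_of_norm_le_const
      (Eventually.of_forall fun n =>
        ((isTest_normed (b n)).convolution hζ hζs).continuous.aestronglyMeasurable)
      ⟨C, Eventually.of_forall fun n => ae_of_all _ (norm_normed_convolution_le (b n) hC)⟩
      (ae_of_all _ (ContDiffBump.convolution_tendsto_right_of_continuous hb hζ))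
  refine hlim.congr' ?_
  filter_upwards [h.eventually_eq_one (R + 1), h.eventually_pderiv_eq_zero (R + 1) i]
    with n hone hzero
  have hball (x : ℝ^N) : ζ x = 0 ∨ ‖x‖ < R + 1 := or_iff_not_imp_left.2 fun hx =>
    (hR x (subset_tsupport _ hx)).trans_lt (lt_add_one R)
  have hηζ : η n * ζ = ζ := funext fun x => (hball x).elim (fun hx => by simp [hx])
    fun hx => by simp [hone x hx]
  have hrest (x : ℝ^N) : ζ x * (pderiv i (η n) * ((b n).normed volume ⋆ u)) x = 0 :=
    (hball x).elim (fun hx => by simp [hx]) fun hx => by simp [hzero x hx]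
  rw [integral_testGrad_cutoffMoll (b n) (h.isTest n) hu hμ hζ hζs, hηζ]
  simp only [hrest, integral_zero, add_zero]

end IsAnisotropicCutoff

theorem critExp_mul_sub {p : Fin N → ℝ} (hsum : 1 < ∑ i, 1 / p i) :
    critExp p * (∑ i, 1 / p i - 1) = N :=
  div_mul_cancel₀ _ (sub_pos.2 hsum).ne'

theorem two_le_dim {p : Fin N → ℝ} (hp : ∀ i, 1 ≤ p i) (hsum : 1 < ∑ i, 1 / p i) : 2 ≤ N := by
  have hN : ∑ i, 1 / p i ≤ N := by
    simpa using Finset.sum_le_card_nsmul Finset.univ (fun i => 1 / p i) 1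
      fun i _ => (div_le_one (one_pos.trans_le (hp i))).2 (hp i)
  exact_mod_cast hsum.trans_le hN

/-- The standing assumptions on the exponents: `p_i = 1` for the first `N₁` indices, `p_i > 1` for
the others, `∑ 1/p_i > 1` and `max p_i < p*`. -/
structure AdmissibleExponents (N₁ : ℕ) (p : Fin N → ℝ) : Prop where
  eq_one : ∀ i : Fin N, (i : ℕ) < N₁ → p i = 1
  one_lt : ∀ i : Fin N, N₁ ≤ (i : ℕ) → 1 < p i
  one_lt_sum : 1 < ∑ i, 1 / p i
  lt_critExp : ∀ i, p i < critExp p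

namespace AdmissibleExponents

variable {N₁ : ℕ} {p : Fin N → ℝ} (h : AdmissibleExponents N₁ p)
include h

theorem one_le (i : Fin N) : 1 ≤ p i :=
  (lt_or_ge (i : ℕ) N₁).elim (fun hi => (h.eq_one i hi).ge) fun hi => (h.one_lt i hi).le

theorem pos (i : Fin N) : 0 < p i := one_pos.trans_le (h.one_le i)

theorem one_lt_critExp : 1 < critExp p :=
  have hN := two_le_dim h.one_le h.one_lt_sum
  (h.one_le ⟨0, by omega⟩).trans_lt (h.lt_critExp _)

theorem one_le_ofReal_critExp : 1 ≤ ENNReal.ofReal (critExp p) :=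
  ENNReal.one_le_ofReal.2 h.one_lt_critExp.le

theorem sub_pos (i : Fin N) : 0 < 1 / p i - 1 / critExp p :=
  _root_.sub_pos.2 (one_div_lt_one_div_of_lt (h.pos i) (h.lt_critExp i))

theorem sum_sub : ∑ i, (1 / p i - 1 / critExp p) = 1 := by
  have hq := (one_pos.trans h.one_lt_critExp).ne'
  have hN := critExp_mul_sub h.one_lt_sum
  rw [Finset.sum_sub_distrib, Finset.sum_const, Finset.card_univ, Fintype.card_fin, nsmul_eq_mul,
    ← hN, mul_one_div, mul_div_cancel_left₀ _ hq, sub_sub_cancel]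

end AdmissibleExponents

/-- The test functions `us n` approximate `u`, with partial derivatives `D`: `us n → u` in `L^{p*}`,
`∂_i (us n) → ∂_i u` in `L^{p_i}` for the last indices and vaguely for the first ones, and the
masses of the latter exceed those of `u` by an error tending to `0`, the same for all groups of
indices. -/
structure IsTestApprox (N₁ : ℕ) (p : Fin N → ℝ) (us : ℕ → ℝ^N → ℝ) (u : ℝ^N → ℝ)
    (D : Grad N) : Prop where
  isTest : ∀ n, IsTest (us n)
  tendsto_sub :
    Tendsto (fun n => eLpNorm (us n - u) (ENNReal.ofReal (critExp p)) volume) atTop (𝓝 0)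
  tendsto_pderiv_sub : ∀ i ∈ lastIdx N N₁, Tendsto
    (fun n => eLpNorm (pderiv i (us n) - D.func i) (ENNReal.ofReal (p i)) volume) atTop (𝓝 0)
  vague : ∀ i ∈ firstIdx N N₁, Vague (fun n => (testGrad (us n)).meas i) (D.meas i)
  exists_error : ∃ ε : ℕ → ℝ≥0∞, Tendsto ε atTop (𝓝 0) ∧ ∀ S ⊆ firstIdx N N₁, ∀ n,
    totalMass S (testGrad (us n)).meas ≤ totalMass S D.meas + ε n

theorem exists_isTestApprox {N₁ : ℕ} {p : Fin N → ℝ} (hp : AdmissibleExponents N₁ p)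
    {u : ℝ^N → ℝ} {D : Grad N} (hD : IsBVGrad N₁ p u D) : ∃ us, IsTestApprox N₁ p us u D := by
  obtain ⟨η, hη⟩ := exists_isAnisotropicCutoff (N := N) hp.sub_pos hp.sum_sub
  let b (n : ℕ) : ContDiffBump (0 : ℝ^N) :=
    ⟨1 / ((n : ℝ) + 1) / 2, 1 / ((n : ℝ) + 1), by positivity, half_lt_self (by positivity)⟩
  have hb : Tendsto (fun n => (b n).rOut) atTop (𝓝 0) := tendsto_one_div_add_atTop_nhds_zero_nat
  have hq := hp.one_lt_critExp.le
  have huL := hD.memLp.locallyIntegrable hp.one_le_ofReal_critExp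
  have hholder (i : Fin N) : 1 / p i = (1 / p i - 1 / critExp p) + 1 / critExp p :=
    (sub_add_cancel _ _).symm
  let error (n : ℕ) (i : Fin N) : ℝ≥0∞ :=
    eLpNorm (pderiv i (η n) * ((b n).normed volume ⋆ u)) 1 volume
  have herror (i : Fin N) (hi : i ∈ firstIdx N N₁) :
      Tendsto (fun n => error n i) atTop (𝓝 0) := by
    have hlim := hη.tendsto_eLpNorm_pderiv_mul hb (hp.sub_pos i) hq (hp.one_le i) (hholder i)
      hD.memLp
    simpa only [hp.eq_one i (Finset.mem_filter.1 hi).2, ENNReal.ofReal_one] using hlim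
  refine ⟨fun n => cutoffMoll (η n) (b n) u, fun n => (hη.isTest n).cutoffMoll (b n) huL,
    hη.tendsto_eLpNorm_cutoffMoll_sub hb hq hD.memLp, fun i hi =>
      hη.tendsto_eLpNorm_pderiv_cutoffMoll_sub hb (hp.sub_pos i) hq (hp.one_le i) (hholder i)
        hD.memLp (hD.func_memLp i hi) (hD.func i hi),
    fun i hi => hη.vague_testGrad_cutoffMoll hb huL (hD.meas i hi),
    fun n => ∑ i ∈ firstIdx N N₁, error n i, ?_, fun S hS n => ?_⟩
  · simpa only [Finset.sum_const_zero] using tendsto_finsetSum _ herror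
  · exact (totalMass_testGrad_cutoffMoll_le (b n) (hη.isTest n) (hη.abs_le_one n) huL
      fun i hi => hD.meas i (hS hi)).trans
      (add_le_add_right (Finset.sum_le_sum_of_subset hS) _)

/-! ### The Troisi inequality for test functions -/

section GagliardoNirenberg

variable {ι : Type*}

theorem ennreal_rpow_sum (a : ℝ≥0∞) (s : Finset ι) {f : ι → ℝ} (hf : ∀ i ∈ s, 0 ≤ f i) :
    a ^ ∑ i ∈ s, f i = ∏ i ∈ s, a ^ f i := by
  induction s using Finset.cons_induction with
  | empty => simp
  | cons j s hj ih =>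
    have hs : ∀ i ∈ s, 0 ≤ f i := fun i hi => hf i (Finset.mem_cons_of_mem hi)
    rw [Finset.sum_cons, Finset.prod_cons, ← ih hs, ENNReal.rpow_add_of_nonneg _ _
      (hf j (Finset.mem_cons_self j s)) (Finset.sum_nonneg hs)]

/-- Apply the grid-lines lemma to the sum of the `F i`, each divided by its integral. -/
theorem lintegral_prod_lintegral_rpow_le [Fintype ι] [DecidableEq ι] {A : ι → Type*}
    [∀ i, MeasurableSpace (A i)] (μ : ∀ i, Measure (A i)) [∀ i, SigmaFinite (μ i)] {r : ℝ}
    (hr : Real.HolderConjugate (Fintype.card ι) r) {F : ι → (∀ i, A i) → ℝ≥0∞}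
    (hF : ∀ i, Measurable (F i)) (h0 : ∀ i, ∫⁻ y, F i y ∂Measure.pi μ ≠ 0)
    (htop : ∀ i, ∫⁻ y, F i y ∂Measure.pi μ ≠ ⊤) :
    ∫⁻ y, ∏ i, (∫⁻ t, F i (Function.update y i t) ∂μ i) ^ (1 / (Fintype.card ι - 1 : ℝ))
        ∂Measure.pi μ ≤
      (Fintype.card ι : ℝ≥0∞) ^ r *
        ∏ i, (∫⁻ y, F i y ∂Measure.pi μ) ^ (1 / (Fintype.card ι - 1 : ℝ)) := by
  set s : ℝ := 1 / (Fintype.card ι - 1 : ℝ)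
  have hs : 0 ≤ s := one_div_nonneg.2 (sub_nonneg.2 hr.lt.le)
  let c (i : ι) : ℝ≥0∞ := ∫⁻ y, F i y ∂Measure.pi μ
  let f (y : ∀ i, A i) : ℝ≥0∞ := ∑ i, (c i)⁻¹ * F i y
  have hf : Measurable f := Finset.measurable_sum _ fun i _ => (hF i).const_mul _
  have hFf (i : ι) (y : ∀ i, A i) : F i y ≤ c i * f y := by
    calc F i y = c i * ((c i)⁻¹ * F i y) := by
          rw [← mul_assoc, ENNReal.mul_inv_cancel (h0 i) (htop i), one_mul]
      _ ≤ c i * f y := by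
          gcongr
          exact Finset.single_le_sum (f := fun i => (c i)⁻¹ * F i y) (fun _ _ => zero_le)
            (Finset.mem_univ i)
  have hint : ∫⁻ y, f y ∂Measure.pi μ = Fintype.card ι := by
    rw [lintegral_finsetSum _ fun i _ => (hF i).const_mul _]
    simp only [lintegral_const_mul _ (hF _)]
    exact (Finset.sum_congr rfl fun i _ => ENNReal.inv_mul_cancel (h0 i) (htop i)).trans (by simp)
  calc ∫⁻ y, ∏ i, (∫⁻ t, F i (Function.update y i t) ∂μ i) ^ s ∂Measure.pi μ
      ≤ ∫⁻ y, (∏ i, c i ^ s) * ∏ i, (∫⁻ t, f (Function.update y i t) ∂μ i) ^ s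
          ∂Measure.pi μ := by
        refine lintegral_mono fun y => ?_
        rw [← Finset.prod_mul_distrib]
        refine Finset.prod_le_prod' fun i _ => ?_
        rw [← ENNReal.mul_rpow_of_nonneg _ _ hs, ← lintegral_const_mul' _ _ (htop i)]
        exact ENNReal.rpow_le_rpow (lintegral_mono fun t => hFf i _) hs
    _ = (∏ i, c i ^ s) *
          ∫⁻ y, ∏ i, (∫⁻ t, f (Function.update y i t) ∂μ i) ^ s ∂Measure.pi μ :=
        lintegral_const_mul' _ _
          (ENNReal.prod_ne_top fun i _ => ENNReal.rpow_ne_top_of_nonneg hs (htop i))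
    _ ≤ (∏ i, c i ^ s) * (Fintype.card ι : ℝ≥0∞) ^ r := by
        rw [← hint]
        gcongr
        exact lintegral_prod_lintegral_pow_le μ hr hf
    _ = (Fintype.card ι : ℝ≥0∞) ^ r * ∏ i, c i ^ s := mul_comm _ _

theorem rpow_le_of_rpow_le_prod [Fintype ι] {X C : ℝ≥0∞} (hX0 : X ≠ 0) (hX : X ≠ ⊤) {n q : ℝ}
    (hn : 1 < n) {e : ι → ℝ} (he : ∀ i, 0 ≤ e i) (hexp : ∑ i, e i = q * (n - 1) - n)
    {k : ι → ℝ≥0∞}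
    (h : X ^ q ≤ C ^ (n / (n - 1)) * ∏ i, (k i * X ^ e i) ^ (1 / (n - 1))) :
    X ^ n ≤ C ^ n * ∏ i, k i := by
  have hn1 : 0 < n - 1 := sub_pos.2 hn
  have hpow : X ^ n * X ^ ∑ i, e i ≤ C ^ n * (∏ i, k i) * X ^ ∑ i, e i := by
    calc X ^ n * X ^ ∑ i, e i = (X ^ q) ^ (n - 1) := by
          rw [← ENNReal.rpow_add _ _ hX0 hX, ← ENNReal.rpow_mul, hexp, add_sub_cancel]
      _ ≤ (C ^ (n / (n - 1)) * ∏ i, (k i * X ^ e i) ^ (1 / (n - 1))) ^ (n - 1) :=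
          ENNReal.rpow_le_rpow h hn1.le
      _ = C ^ n * (∏ i, k i) * X ^ ∑ i, e i := by
          rw [ENNReal.prod_rpow_of_nonneg (one_div_nonneg.2 hn1.le),
            ENNReal.mul_rpow_of_nonneg _ _ hn1.le, ← ENNReal.rpow_mul, ← ENNReal.rpow_mul,
            div_mul_cancel₀ _ hn1.ne', one_div_mul_cancel hn1.ne', ENNReal.rpow_one,
            Finset.prod_mul_distrib, ← ennreal_rpow_sum X _ fun i _ => he i, mul_assoc]
  have he0 : 0 ≤ ∑ i, e i := Finset.sum_nonneg fun i _ => he i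
  exact (ENNReal.mul_le_mul_iff_left (by simp [ENNReal.rpow_eq_zero_iff, hX0, hX])
    (ENNReal.rpow_ne_top_of_nonneg he0 hX)).1 hpow

theorem enorm_rpow_one_add_le_lintegral_deriv {f : ℝ → ℝ} (hf : ContDiff ℝ 1 f)
    (hs : HasCompactSupport f) {e : ℝ} (he : 0 ≤ e) (x : ℝ) :
    ‖f x‖ₑ ^ (1 + e) ≤ ∫⁻ t, ENNReal.ofReal ((1 + e) * ‖f t‖ ^ e * ‖deriv f t‖) := by
  have hdrop (g : ℝ → ℝ≥0∞) : ∫⁻ t in Set.Iic x, g t ≤ ∫⁻ t, g t :=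
    lintegral_mono' Measure.restrict_le_self le_rfl
  rcases he.eq_or_lt with rfl | he
  · simpa [← Real.enorm_eq_ofReal_abs] using (hs.enorm_le_lintegral_Ici_deriv hf x).trans (hdrop _)
  have hγ : 1 < 1 + e := lt_add_of_pos_right 1 he
  have hγ0 : 0 < 1 + e := one_pos.trans hγ
  have hpow := (hs.comp_left (g := fun y => ‖y‖ ^ (1 + e)) (by simp [hγ0.ne'])
    ).enorm_le_lintegral_Ici_deriv (hf.norm_rpow hγ) x
  calc ‖f x‖ₑ ^ (1 + e) = ‖‖f x‖ ^ (1 + e)‖ₑ := by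
        rw [Real.enorm_rpow_of_nonneg (norm_nonneg _) hγ0.le, enorm_norm]
    _ ≤ ∫⁻ t, ‖deriv (fun t => ‖f t‖ ^ (1 + e)) t‖ₑ := hpow.trans (hdrop _)
    _ ≤ ∫⁻ t, ENNReal.ofReal ((1 + e) * ‖f t‖ ^ e * ‖deriv f t‖) := by
        refine lintegral_mono fun t => ?_
        have hderiv := norm_fderiv_norm_rpow_le (hf.differentiable one_ne_zero) (x := t) hγ
        rw [← norm_deriv_eq_norm_fderiv, ← norm_deriv_eq_norm_fderiv, add_sub_cancel_left]
          at hderiv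
        rw [← ofReal_norm]
        exact ENNReal.ofReal_le_ofReal hderiv

theorem lintegral_rpow_mul_le {X : Type*} [MeasurableSpace X] {μ : Measure X} {f g : X → ℝ}
    (hf : AEMeasurable f μ) (hg : AEMeasurable g μ) {p q : ℝ} (hp : 1 ≤ p) (hq : 0 < q) :
    ∫⁻ x, ‖f x‖ₑ ^ (q * (1 - 1 / p)) * ‖g x‖ₑ ∂μ ≤
      eLpNorm g (ENNReal.ofReal p) μ * eLpNorm f (ENNReal.ofReal q) μ ^ (q * (1 - 1 / p)) := by
  rcases hp.eq_or_lt with rfl | hp1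
  · simp [eLpNorm_one_eq_lintegral_enorm]
  have hp0 : 0 < p := one_pos.trans hp1
  have hpq := (Real.HolderConjugate.conjExponent hp1).symm
  have hr : 1 - 1 / p = (Real.conjExponent p)⁻¹ := by
    rw [one_div, ← hpq.symm.inv_add_inv_eq_one, add_sub_cancel_left]
  rw [hr, eLpNorm_eq_lintegral_rpow_enorm_toReal (ENNReal.ofReal_pos.2 hq).ne'
      ENNReal.ofReal_ne_top, eLpNorm_eq_lintegral_rpow_enorm_toReal
      (ENNReal.ofReal_pos.2 hp0).ne' ENNReal.ofReal_ne_top,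
    ENNReal.toReal_ofReal hq.le, ENNReal.toReal_ofReal hp0.le, mul_comm (_ ^ (1 / p))]
  refine (ENNReal.lintegral_mul_le_Lp_mul_Lq μ hpq (hf.enorm.pow_const _) hg.enorm).trans_eq ?_
  simp_rw [← ENNReal.rpow_mul]
  rw [← mul_assoc (1 / q), one_div_mul_cancel hq.ne', one_mul, mul_assoc q,
    inv_mul_cancel₀ hpq.pos.ne', mul_one, one_div (Real.conjExponent p)]

end GagliardoNirenberg

section Troisi

theorem one_sub_one_div_nonneg {p : ℝ} (hp : 1 ≤ p) : 0 ≤ 1 - 1 / p :=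
  sub_nonneg.2 ((div_le_one (one_pos.trans_le hp)).2 hp)

theorem critExp_pos {p : Fin N → ℝ} (hp : ∀ i, 1 ≤ p i) (hsum : 1 < ∑ i, 1 / p i) :
    0 < critExp p := by
  have hN := two_le_dim hp hsum
  exact div_pos (by positivity) (sub_pos.2 hsum)

theorem sum_critExp_mul_one_sub {p : Fin N → ℝ} (hsum : 1 < ∑ i, 1 / p i) :
    ∑ i, critExp p * (1 - 1 / p i) = critExp p * (N - 1) - N := by
  rw [← Finset.mul_sum, Finset.sum_sub_distrib, Finset.sum_const, Finset.card_univ,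
    Fintype.card_fin, nsmul_one]
  linear_combination -critExp_mul_sub hsum

theorem contDiff_toLp_update (y : Fin N → ℝ) (i : Fin N) {n : ℕ∞} :
    ContDiff ℝ n fun t => (WithLp.toLp 2 (Function.update y i t) : ℝ^N) :=
  (PiLp.continuousLinearEquiv 2 ℝ fun _ : Fin N => ℝ).symm.contDiff.comp (contDiff_update n y i)

theorem hasDerivAt_toLp_update (y : Fin N → ℝ) (i : Fin N) (t : ℝ) :
    HasDerivAt (fun t => (WithLp.toLp 2 (Function.update y i t) : ℝ^N))
      (EuclideanSpace.single i 1) t :=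
  (PiLp.continuousLinearEquiv 2 ℝ fun _ : Fin N =>
    ℝ).symm.toContinuousLinearMap.hasFDerivAt.comp_hasDerivAt t (hasDerivAt_update y i t)

theorem lintegral_toLp (F : ℝ^N → ℝ≥0∞) :
    ∫⁻ y : Fin N → ℝ, F (WithLp.toLp 2 y) = ∫⁻ x, F x :=
  (PiLp.volume_preserving_toLp (Fin N)).lintegral_comp_emb
    (MeasurableEquiv.toLp 2 (Fin N → ℝ)).measurableEmbedding F

/-- A bound for the size of the `i`-th partial derivative of `|φ|^(1 + e)`. -/
noncomputable def powDeriv (e : ℝ) (i : Fin N) (φ : ℝ^N → ℝ) (x : ℝ^N) : ℝ≥0∞ :=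
  ENNReal.ofReal ((1 + e) * ‖φ x‖ ^ e * ‖pderiv i φ x‖)

namespace IsTest

variable {φ : ℝ^N → ℝ} (hφ : IsTest φ)
include hφ

theorem continuous_powDeriv {e : ℝ} (he : 0 ≤ e) (i : Fin N) : Continuous (powDeriv e i φ) :=
  ENNReal.continuous_ofReal.comp ((continuous_const.mul
    (hφ.continuous.norm.rpow_const fun _ => Or.inr he)).mul (hφ.pderiv i).continuous.norm)

theorem enorm_rpow_one_add_le_lintegral_powDeriv (i : Fin N) {e : ℝ} (he : 0 ≤ e)
    (y : Fin N → ℝ) :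
    ‖φ (WithLp.toLp 2 y)‖ₑ ^ (1 + e) ≤
      ∫⁻ t, powDeriv e i φ (WithLp.toLp 2 (Function.update y i t)) := by
  let f (t : ℝ) : ℝ := φ (WithLp.toLp 2 (Function.update y i t))
  have hf : ContDiff ℝ 1 f := (hφ.1.of_le (by simp)).comp (contDiff_toLp_update y i)
  have hs : HasCompactSupport f := hφ.2.comp_isClosedEmbedding
    ((PiLp.homeomorph 2 fun _ : Fin N => ℝ).symm.isClosedEmbedding.comp
      (isClosedEmbedding_update y i))
  have hderiv (t : ℝ) : deriv f t = pderiv i φ (WithLp.toLp 2 (Function.update y i t)) :=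
    ((hφ.differentiable _).hasFDerivAt.comp_hasDerivAt t (hasDerivAt_toLp_update y i t)).deriv
  have hline := enorm_rpow_one_add_le_lintegral_deriv hf hs he (y i)
  simpa only [f, hderiv, Function.update_eq_self, powDeriv] using hline

theorem lintegral_powDeriv_ne_zero (hne : φ ≠ 0) (i : Fin N) {e : ℝ} (he : 0 ≤ e) :
    ∫⁻ x, powDeriv e i φ x ≠ 0 := by
  intro hzero
  have hcont := hφ.continuous_powDeriv he i
  have hpd : powDeriv e i φ = 0 := (hcont.ae_eq_iff_eq volume continuous_zero).1
    ((lintegral_eq_zero_iff hcont.measurable).1 hzero)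
  refine hne (funext fun x => ?_)
  have hx := hφ.enorm_rpow_one_add_le_lintegral_powDeriv i he (WithLp.ofLp x)
  simpa [hpd, ENNReal.rpow_eq_zero_iff, add_pos_of_pos_of_nonneg one_pos he] using hx

theorem lintegral_powDeriv_le (i : Fin N) {p q : ℝ} (hp : 1 ≤ p) (hq : 0 < q) :
    ∫⁻ x, powDeriv (q * (1 - 1 / p)) i φ x ≤
      ENNReal.ofReal (1 + q * (1 - 1 / p)) * eLpNorm (pderiv i φ) (ENNReal.ofReal p) volume *
        eLpNorm φ (ENNReal.ofReal q) volume ^ (q * (1 - 1 / p)) := by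
  have he : 0 ≤ q * (1 - 1 / p) := mul_nonneg hq.le (one_sub_one_div_nonneg hp)
  have hsplit (x : ℝ^N) : powDeriv (q * (1 - 1 / p)) i φ x =
      ENNReal.ofReal (1 + q * (1 - 1 / p)) * (‖φ x‖ₑ ^ (q * (1 - 1 / p)) * ‖pderiv i φ x‖ₑ) := by
    rw [powDeriv, mul_assoc, ENNReal.ofReal_mul (by positivity), ENNReal.ofReal_mul (by positivity),
      ← ENNReal.ofReal_rpow_of_nonneg (norm_nonneg _) he, ofReal_norm, ofReal_norm]
  simp only [hsplit]
  rw [lintegral_const_mul' _ _ ENNReal.ofReal_ne_top, mul_assoc]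
  gcongr
  exact lintegral_rpow_mul_le hφ.continuous.aemeasurable
    (hφ.pderiv i).continuous.aemeasurable hp hq

theorem eLpNorm_rpow_le_lintegral_prod {q : ℝ} (hN : 1 < N) (hq : 0 < q) {e : Fin N → ℝ}
    (he : ∀ i, 0 ≤ e i) (hexp : ∑ i, e i = q * (N - 1) - N) :
    eLpNorm φ (ENNReal.ofReal q) volume ^ q ≤
      ∫⁻ y : Fin N → ℝ, ∏ i, (∫⁻ t, powDeriv (e i) i φ
        (WithLp.toLp 2 (Function.update y i t))) ^ (1 / (N - 1 : ℝ)) := by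
  have hN1 : (0 : ℝ) < N - 1 := sub_pos.2 (by exact_mod_cast hN)
  have hsum : ∑ i, (1 + e i) * (1 / (N - 1 : ℝ)) = q := by
    rw [← Finset.sum_mul, Finset.sum_add_distrib, hexp, Finset.sum_const, Finset.card_univ,
      Fintype.card_fin, nsmul_one, add_sub_cancel, mul_one_div, mul_div_cancel_right₀ _ hN1.ne']
  rw [eLpNorm_eq_lintegral_rpow_enorm_toReal (ENNReal.ofReal_pos.2 hq).ne' ENNReal.ofReal_ne_top,
    ENNReal.toReal_ofReal hq.le, ← ENNReal.rpow_mul, one_div_mul_cancel hq.ne', ENNReal.rpow_one,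
    ← lintegral_toLp]
  refine lintegral_mono fun y => ?_
  calc ‖φ (WithLp.toLp 2 y)‖ₑ ^ q
      = ∏ i, (‖φ (WithLp.toLp 2 y)‖ₑ ^ (1 + e i)) ^ (1 / (N - 1 : ℝ)) := by
        simp_rw [← ENNReal.rpow_mul]
        rw [← ennreal_rpow_sum _ _ fun i _ => mul_nonneg (add_nonneg zero_le_one (he i))
          (one_div_nonneg.2 hN1.le), hsum]
    _ ≤ _ := Finset.prod_le_prod' fun i _ => ENNReal.rpow_le_rpow
        (hφ.enorm_rpow_one_add_le_lintegral_powDeriv i (he i) y) (one_div_nonneg.2 hN1.le)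

theorem eLpNorm_critExp_rpow_le_prod {p : Fin N → ℝ} (hp : ∀ i, 1 ≤ p i)
    (hsum : 1 < ∑ i, 1 / p i) :
    eLpNorm φ (ENNReal.ofReal (critExp p)) volume ^ (N : ℝ) ≤
      (N : ℝ≥0∞) ^ (N : ℝ) * ∏ i, ENNReal.ofReal (1 + critExp p * (1 - 1 / p i)) *
        eLpNorm (pderiv i φ) (ENNReal.ofReal (p i)) volume := by
  have hN := two_le_dim hp hsum
  have hN1 : (1 : ℝ) < N := by exact_mod_cast hN
  have hq := critExp_pos hp hsum
  have hexp := sum_critExp_mul_one_sub hsum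
  set q := critExp p
  let e (i : Fin N) : ℝ := q * (1 - 1 / p i)
  have he (i : Fin N) : 0 ≤ e i := mul_nonneg hq.le (one_sub_one_div_nonneg (hp i))
  rcases eq_or_ne φ 0 with rfl | hne
  · rw [eLpNorm_zero, ENNReal.zero_rpow_of_pos (one_pos.trans hN1)]
    exact zero_le
  have hqE : ENNReal.ofReal q ≠ 0 := (ENNReal.ofReal_pos.2 hq).ne'
  have hX0 : eLpNorm φ (ENNReal.ofReal q) volume ≠ 0 := fun h => hne
    ((hφ.continuous.ae_eq_iff_eq volume continuous_zero).1
      ((eLpNorm_eq_zero_iff hφ.continuous.aestronglyMeasurable hqE).1 h))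
  have hXtop := (hφ.memLp (ENNReal.ofReal q)).2.ne
  have hbound (i : Fin N) := hφ.lintegral_powDeriv_le i (hp i) hq
  have hfinite (i : Fin N) : ∫⁻ x, powDeriv (e i) i φ x ≠ ⊤ :=
    ne_top_of_le_ne_top (ENNReal.mul_ne_top (ENNReal.mul_ne_top ENNReal.ofReal_ne_top
      ((hφ.pderiv i).memLp _).2.ne) (ENNReal.rpow_ne_top_of_nonneg (he i) hXtop)) (hbound i)
  have hconj : Real.HolderConjugate (Fintype.card (Fin N)) (N / (N - 1)) := by
    rw [Fintype.card_fin]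
    exact Real.HolderConjugate.conjExponent hN1
  have htoLp : Measurable fun y : Fin N → ℝ => (WithLp.toLp 2 y : ℝ^N) :=
    (PiLp.volume_preserving_toLp (Fin N)).measurable
  have hgrid := lintegral_prod_lintegral_rpow_le (fun _ : Fin N => (volume : Measure ℝ)) hconj
    (F := fun i y => powDeriv (e i) i φ (WithLp.toLp 2 y))
    (fun i => (hφ.continuous_powDeriv (he i) i).measurable.comp htoLp)
    (fun i => (lintegral_toLp _).trans_ne (hφ.lintegral_powDeriv_ne_zero hne i (he i)))
    (fun i => (lintegral_toLp _).trans_ne (hfinite i))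
  rw [Fintype.card_fin] at hgrid
  refine rpow_le_of_rpow_le_prod hX0 hXtop hN1 he hexp ?_
  refine (hφ.eLpNorm_rpow_le_lintegral_prod hN hq he hexp).trans (hgrid.trans ?_)
  gcongr with i
  exact (lintegral_toLp _).trans_le (hbound i)

end IsTest

theorem exists_troisi_test {p : Fin N → ℝ} (hp : ∀ i, 1 ≤ p i) (hsum : 1 < ∑ i, 1 / p i) :
    ∃ T₀ : ℝ, 0 < T₀ ∧ ∀ φ : ℝ^N → ℝ, IsTest φ →
      ENNReal.ofReal T₀ * eLpNorm φ (ENNReal.ofReal (critExp p)) volume ≤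
        ∏ i, eLpNorm (pderiv i φ) (ENNReal.ofReal (p i)) volume ^ (1 / (N : ℝ)) := by
  have hN := two_le_dim hp hsum
  have hN0 : (0 : ℝ) < N := by positivity
  have hγ (i : Fin N) : 0 < 1 + critExp p * (1 - 1 / p i) := add_pos_of_pos_of_nonneg one_pos
    (mul_nonneg (critExp_pos hp hsum).le (one_sub_one_div_nonneg (hp i)))
  set A : ℝ := (N : ℝ) ^ (N : ℝ) * ∏ i, (1 + critExp p * (1 - 1 / p i)) with hA
  have hA0 : 0 < A := mul_pos (by positivity) (Finset.prod_pos fun i _ => hγ i)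
  refine ⟨(A ^ (1 / (N : ℝ)))⁻¹, by positivity, fun φ hφ => ?_⟩
  have hA' : ENNReal.ofReal A =
      (N : ℝ≥0∞) ^ (N : ℝ) * ∏ i, ENNReal.ofReal (1 + critExp p * (1 - 1 / p i)) := by
    rw [hA, ENNReal.ofReal_mul (by positivity), ENNReal.ofReal_prod_of_nonneg fun i _ => (hγ i).le,
      ← ENNReal.ofReal_rpow_of_pos hN0, ENNReal.ofReal_natCast]
  have hpow := hφ.eLpNorm_critExp_rpow_le_prod hp hsum
  rw [Finset.prod_mul_distrib, ← mul_assoc, ← hA'] at hpow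
  have hroot := ENNReal.rpow_le_rpow hpow (one_div_nonneg.2 hN0.le)
  rw [← ENNReal.rpow_mul, mul_one_div_cancel hN0.ne', ENNReal.rpow_one,
    ENNReal.mul_rpow_of_nonneg _ _ (one_div_nonneg.2 hN0.le), ENNReal.ofReal_rpow_of_pos hA0,
    ← ENNReal.prod_rpow_of_nonneg (one_div_nonneg.2 hN0.le)] at hroot
  rw [ENNReal.ofReal_inv_of_pos (by positivity)]
  exact ENNReal.inv_mul_le_iff (by positivity) ENNReal.ofReal_ne_top |>.2 hroot

end Troisi

/-! ### Weak compactness -/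

section WeakCompactness

open scoped NNReal

theorem lintegral_rpow_le_of_forall_lintegral_mul_le {X : Type*} [MeasurableSpace X]
    {μ : Measure X} [SigmaFinite μ] {q r : ℝ} (hqr : q.HolderConjugate r) {w : X → ℝ≥0} {C : ℝ≥0∞}
    (h : ∀ v : X → ℝ≥0, Measurable v → ∫⁻ x, (v x : ℝ≥0∞) ^ r ∂μ ≠ ⊤ →
      ∫⁻ x, v x * w x ∂μ ≤ C * (∫⁻ x, (v x : ℝ≥0∞) ^ r ∂μ) ^ (1 / r)) :
    ∫⁻ x, (w x : ℝ≥0∞) ^ q ∂μ ≤ C ^ q := by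
  simp_rw [← ENNReal.coe_rpow_of_nonneg _ hqr.nonneg]
  refine le_of_forall_lt fun L hL => ?_
  obtain ⟨g, hgw, hgtop, hLg⟩ := exists_lt_lintegral_simpleFunc_of_lt_lintegral hL
  refine hLg.trans_le ?_
  set J : ℝ≥0∞ := ∫⁻ x, g x ∂μ
  rcases eq_or_ne J 0 with hJ0 | hJ0
  · simp [hJ0]
  have hsum : 1 / r + 1 / q = 1 := by simpa only [one_div] using hqr.symm.inv_add_inv_eq_one
  have hv : ∫⁻ x, ((g x ^ (1 / r) : ℝ≥0) : ℝ≥0∞) ^ r ∂μ = J := lintegral_congr fun x => by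
    rw [← ENNReal.coe_rpow_of_nonneg _ hqr.symm.nonneg, ← NNReal.rpow_mul,
      one_div_mul_cancel hqr.symm.ne_zero, NNReal.rpow_one]
  have hgle (x : X) : g x ≤ g x ^ (1 / r) * w x := by
    calc g x = g x ^ (1 / r) * g x ^ (1 / q) := by
          rw [← NNReal.rpow_add_of_nonneg _ hqr.symm.one_div_nonneg hqr.one_div_nonneg, hsum,
            NNReal.rpow_one]
      _ ≤ g x ^ (1 / r) * w x := by
          gcongr
          rw [one_div, NNReal.rpow_inv_le_iff hqr.pos]
          exact hgw x
  have hJ : J ≤ C * J ^ (1 / r) := by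
    calc J ≤ ∫⁻ x, ((g x ^ (1 / r) : ℝ≥0) : ℝ≥0∞) * w x ∂μ :=
          lintegral_mono fun x => by
            rw [← ENNReal.coe_mul]
            exact ENNReal.coe_le_coe.2 (hgle x)
      _ ≤ C * J ^ (1 / r) := by
          have := h (fun x => g x ^ (1 / r)) (g.measurable.pow_const _) (hv ▸ hgtop.ne)
          rwa [hv] at this
  have hroot : J ^ (1 / q) ≤ C := by
    refine (ENNReal.mul_le_mul_iff_left (ENNReal.rpow_pos (pos_iff_ne_zero.2 hJ0) hgtop.ne).ne'
      (ENNReal.rpow_ne_top_of_ne_zero hJ0 hgtop.ne)).1 (?_ : _ * J ^ (1 / r) ≤ C * J ^ (1 / r))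
    rwa [← ENNReal.rpow_add _ _ hJ0 hgtop.ne, add_comm, hsum, ENNReal.rpow_one]
  rwa [one_div, ENNReal.rpow_inv_le_iff hqr.pos] at hroot

theorem enorm_integral_mul_le {X : Type*} [MeasurableSpace X] {μ : Measure X} {q r : ℝ}
    (hqr : q.HolderConjugate r) {f g : X → ℝ}
    (hf : AEStronglyMeasurable f μ) (hg : AEStronglyMeasurable g μ) :
    ‖∫ x, f x * g x ∂μ‖ₑ ≤
      eLpNorm f (ENNReal.ofReal r) μ * eLpNorm g (ENNReal.ofReal q) μ := by
  have hholder := eLpNorm_mul_le_of_holder (a := r⁻¹) (r := 1) (inv_pos.2 hqr.symm.pos) hqr.pos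
    (by rw [one_div, one_div, hqr.symm.inv_add_inv_eq_one, inv_one]) hf hg
  rw [ENNReal.ofReal_one, eLpNorm_one_eq_lintegral_enorm, inv_inv] at hholder
  exact (enorm_integral_le_lintegral_enorm _).trans hholder

theorem integral_mul_posPart_sub_integral_mul_negPart {X : Type*} [TopologicalSpace X] [T2Space X]
    [SecondCountableTopology X] [MeasurableSpace X] [BorelSpace X] {μ : Measure X} {f g : X → ℝ}
    (hf : Continuous f) (hs : HasCompactSupport f) (hg : LocallyIntegrable g μ) :
    ∫ x, f x * max (g x) 0 ∂μ - ∫ x, f x * max (-g x) 0 ∂μ = ∫ x, f x * g x ∂μ := by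
  have hint : Integrable (fun x => f x * g x) μ :=
    hg.integrable_smul_left_of_hasCompactSupport hf hs
  have hgm := hg.aestronglyMeasurable
  have hpos (t : ℝ) : ‖max t 0‖ ≤ ‖t‖ := by
    rw [Real.norm_of_nonneg (le_max_right t 0)]
    exact max_le (le_abs_self t) (abs_nonneg t)
  rw [← integral_sub]
  · exact integral_congr_ae (ae_of_all _ fun x => by
      rcases le_total 0 (g x) with h | h <;> simp [h])
  · refine hint.mono (hf.aestronglyMeasurable.mul (hgm.sup aestronglyMeasurable_const))
      (ae_of_all _ fun x => ?_)
    simpa only [norm_mul] using mul_le_mul_of_nonneg_left (hpos (g x)) (norm_nonneg (f x))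
  · refine hint.mono (hf.aestronglyMeasurable.mul (hgm.neg.sup aestronglyMeasurable_const))
      (ae_of_all _ fun x => ?_)
    simpa only [norm_mul, norm_neg] using
      mul_le_mul_of_nonneg_left (hpos (-g x)) (norm_nonneg (f x))

variable {X : Type*} [TopologicalSpace X] [T2Space X] [LocallyCompactSpace X] [MeasurableSpace X]
  [BorelSpace X] {μ ν : Measure X} {q r : ℝ} {C : ℝ≥0∞} {ι : Type*}

theorem measure_le_of_forall_lintegral_le [ν.Regular] {U : Set X} (hU : IsOpen U)
    (h : ∀ f : X → ℝ, Continuous f → HasCompactSupport f → tsupport f ⊆ U →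
      (∀ x, 0 ≤ f x ∧ f x ≤ 1) → ∫⁻ x, ENNReal.ofReal (f x) ∂ν ≤ C) : ν U ≤ C := by
  rw [hU.measure_eq_iSup_isCompact]
  refine iSup₂_le fun K hKU => iSup_le fun hK => ?_
  obtain ⟨f, hf1, hfs, hfU, hf01⟩ := exists_continuousMap_one_of_isCompact_subset_isOpen hK hU hKU
  calc ν K = ∫⁻ x, K.indicator 1 x ∂ν := (lintegral_indicator_one hK.measurableSet).symm
    _ ≤ ∫⁻ x, ENNReal.ofReal (f x) ∂ν :=
        lintegral_mono (Set.indicator_le fun x hx => by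
          rw [hf1 hx, Pi.one_apply, Pi.one_apply, ENNReal.ofReal_one])
    _ ≤ C := h f f.continuous hfs hfU hf01

theorem absolutelyContinuous_of_lintegral_le_eLpNorm [μ.OuterRegular] [ν.Regular] (hr : 0 < r)
    (hC : C ≠ ⊤)
    (h : ∀ f : X → ℝ, Continuous f → HasCompactSupport f → (∀ x, 0 ≤ f x) →
      ∫⁻ x, ENNReal.ofReal (f x) ∂ν ≤ C * eLpNorm f (ENNReal.ofReal r) μ) :
    ν ≪ μ := by
  have hopen (U : Set X) (hU : IsOpen U) : ν U ≤ C * μ U ^ (1 / r) := by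
    refine measure_le_of_forall_lintegral_le hU fun f hf hs hfU hf01 => ?_
    have hfle : eLpNorm f (ENNReal.ofReal r) μ ≤
        eLpNorm (U.indicator fun _ => (1 : ℝ)) (ENNReal.ofReal r) μ := eLpNorm_mono fun x => by
      by_cases hx : x ∈ U
      · simpa [hx, abs_of_nonneg (hf01 x).1] using (hf01 x).2
      · simp [hx, image_eq_zero_of_notMem_tsupport fun hx' => hx (hfU hx')]
    rw [eLpNorm_indicator_const hU.measurableSet (by simpa using hr) ENNReal.ofReal_ne_top,
      enorm_one, one_mul, ENNReal.toReal_ofReal hr.le] at hfle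
    exact (h f hf hs fun x => (hf01 x).1).trans (by gcongr)
  intro A hA
  have hlim : Tendsto (fun n : ℕ => C * ((n : ℝ≥0∞)⁻¹) ^ (1 / r)) atTop (𝓝 0) := by
    have h0 := ((ENNReal.continuous_rpow_const (y := 1 / r)).tendsto 0).comp
      ENNReal.tendsto_inv_nat_nhds_zero
    rw [ENNReal.zero_rpow_of_pos (by positivity)] at h0
    simpa using ENNReal.Tendsto.const_mul h0 (Or.inr hC)
  refine le_antisymm (ge_of_tendsto' hlim fun n => ?_) zero_le
  obtain ⟨U, hAU, hU, hUn⟩ := A.exists_isOpen_lt_of_lt (μ := μ) ((n : ℝ≥0∞)⁻¹) (by simp [hA])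
  exact (measure_mono hAU).trans ((hopen U hU).trans (by gcongr))

theorem exists_seq_continuous_nonneg_tendsto_eLpNorm [SecondCountableTopology X] [μ.Regular]
    {s : ℝ≥0∞} (hs : s ≠ ⊤)
    {v : X → ℝ} (hv0 : ∀ x, 0 ≤ v x) (hv : MemLp v s μ) :
    ∃ f : ℕ → X → ℝ, (∀ n, Continuous (f n) ∧ HasCompactSupport (f n) ∧ ∀ x, 0 ≤ f n x) ∧
      Tendsto (fun n => eLpNorm (f n - v) s μ) atTop (𝓝 0) := by
  have happrox (n : ℕ) : ∃ f : X → ℝ, (Continuous f ∧ HasCompactSupport f ∧ ∀ x, 0 ≤ f x) ∧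
      eLpNorm (f - v) s μ ≤ (n : ℝ≥0∞)⁻¹ := by
    obtain ⟨f, hfs, hfv, hfc, -⟩ := hv.exists_hasCompactSupport_eLpNorm_sub_le hs
      (ε := (n : ℝ≥0∞)⁻¹) (by simp)
    refine ⟨fun x => max (f x) 0, ⟨hfc.max continuous_const,
      hfs.comp_left (g := fun y => max y 0) (by simp), fun x => le_max_right _ _⟩, ?_⟩
    rw [eLpNorm_sub_comm] at hfv
    refine (eLpNorm_mono fun x => ?_).trans hfv
    simpa only [max_eq_left (hv0 x)] using! abs_max_sub_max_le_abs (f x) (v x) 0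
  choose f hf hfv using happrox
  exact ⟨f, hf, tendsto_of_tendsto_of_tendsto_of_le_of_le tendsto_const_nhds
    ENNReal.tendsto_inv_nat_nhds_zero (fun _ => zero_le) hfv⟩

theorem lintegral_mul_le_eLpNorm_of_continuous [SecondCountableTopology X] [μ.Regular]
    {w : X → ℝ≥0∞} (hw : Measurable w)
    (hr : 1 ≤ r) (hC : C ≠ ⊤)
    (h : ∀ f : X → ℝ, Continuous f → HasCompactSupport f → (∀ x, 0 ≤ f x) →
      ∫⁻ x, ENNReal.ofReal (f x) * w x ∂μ ≤ C * eLpNorm f (ENNReal.ofReal r) μ)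
    {v : X → ℝ} (hv0 : ∀ x, 0 ≤ v x) (hv : MemLp v (ENNReal.ofReal r) μ) :
    ∫⁻ x, ENNReal.ofReal (v x) * w x ∂μ ≤ C * eLpNorm v (ENNReal.ofReal r) μ := by
  obtain ⟨f, hf, hfv⟩ := exists_seq_continuous_nonneg_tendsto_eLpNorm ENNReal.ofReal_ne_top hv0 hv
  have hfmeas (n : ℕ) : AEStronglyMeasurable (f n) μ := (hf n).1.aestronglyMeasurable
  obtain ⟨ns, hns, hae⟩ := (tendstoInMeasure_of_tendsto_eLpNorm
    (ENNReal.ofReal_pos.2 (one_pos.trans_le hr)).ne' hfmeas hv.1 hfv).exists_seq_tendsto_ae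
  have hnorm (n : ℕ) : eLpNorm (f n) (ENNReal.ofReal r) μ ≤
      eLpNorm (f n - v) (ENNReal.ofReal r) μ + eLpNorm v (ENNReal.ofReal r) μ := by
    simpa only [sub_add_cancel] using
      eLpNorm_add_le ((hfmeas n).sub hv.1) hv.1 (ENNReal.one_le_ofReal.2 hr)
  have hlim : Tendsto (fun n => C * (eLpNorm (f (ns n) - v) (ENNReal.ofReal r) μ +
      eLpNorm v (ENNReal.ofReal r) μ)) atTop (𝓝 (C * eLpNorm v (ENNReal.ofReal r) μ)) := by
    have h0 := (hfv.comp hns.tendsto_atTop).add_const (eLpNorm v (ENNReal.ofReal r) μ)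
    rw [zero_add] at h0
    exact ENNReal.Tendsto.const_mul h0 (Or.inr hC)
  calc ∫⁻ x, ENNReal.ofReal (v x) * w x ∂μ
      ≤ ∫⁻ x, liminf (fun n => ENNReal.ofReal (f (ns n) x) * w x) atTop ∂μ := by
        refine lintegral_mono_ae (hae.mono fun x hx => ?_)
        rcases eq_or_ne (ENNReal.ofReal (v x)) 0 with h0 | h0
        · simp [h0]
        · exact (ENNReal.Tendsto.mul_const (ENNReal.tendsto_ofReal hx) (Or.inl h0)).liminf_eq.ge
    _ ≤ liminf (fun n => ∫⁻ x, ENNReal.ofReal (f (ns n) x) * w x ∂μ) atTop :=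
        lintegral_liminf_le fun n => (hf _).1.measurable.ennreal_ofReal.mul hw
    _ ≤ liminf (fun n => C * (eLpNorm (f (ns n) - v) (ENNReal.ofReal r) μ +
          eLpNorm v (ENNReal.ofReal r) μ)) atTop :=
        liminf_le_liminf (Eventually.of_forall fun n =>
          (h _ (hf _).1 (hf _).2.1 (hf _).2.2).trans (by gcongr; exact hnorm _))
    _ = C * eLpNorm v (ENNReal.ofReal r) μ := hlim.liminf_eq

theorem lintegral_rpow_le_of_continuous [SecondCountableTopology X] [μ.Regular]
    (hqr : q.HolderConjugate r)
    {w : X → ℝ≥0} (hw : Measurable w) (hC : C ≠ ⊤)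
    (h : ∀ f : X → ℝ, Continuous f → HasCompactSupport f → (∀ x, 0 ≤ f x) →
      ∫⁻ x, ENNReal.ofReal (f x) * w x ∂μ ≤ C * eLpNorm f (ENNReal.ofReal r) μ) :
    ∫⁻ x, (w x : ℝ≥0∞) ^ q ∂μ ≤ C ^ q := by
  refine lintegral_rpow_le_of_forall_lintegral_mul_le hqr fun v hv hvr => ?_
  have hnorm : eLpNorm (fun x => (v x : ℝ)) (ENNReal.ofReal r) μ =
      (∫⁻ x, (v x : ℝ≥0∞) ^ r ∂μ) ^ (1 / r) := by
    rw [eLpNorm_eq_lintegral_rpow_enorm_toReal (ENNReal.ofReal_pos.2 hqr.symm.pos).ne'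
      ENNReal.ofReal_ne_top, ENNReal.toReal_ofReal hqr.symm.nonneg]
    simp only [NNReal.enorm_eq]
  have hmem : MemLp (fun x => (v x : ℝ)) (ENNReal.ofReal r) μ :=
    ⟨hv.coe_nnreal_real.aestronglyMeasurable,
      hnorm ▸ ENNReal.rpow_lt_top_of_nonneg hqr.symm.one_div_nonneg hvr⟩
  rw [← hnorm]
  simpa only [ENNReal.ofReal_coe_nnreal] using lintegral_mul_le_eLpNorm_of_continuous
    hw.coe_nnreal_ennreal hqr.symm.lt.le hC h (fun x => NNReal.coe_nonneg _) hmem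

theorem exists_memLp_density [SecondCountableTopology X] [μ.Regular] [ν.Regular]
    (hqr : q.HolderConjugate r) (hC : C ≠ ⊤)
    (h : ∀ f : X → ℝ, Continuous f → HasCompactSupport f → (∀ x, 0 ≤ f x) →
      ∫⁻ x, ENNReal.ofReal (f x) ∂ν ≤ C * eLpNorm f (ENNReal.ofReal r) μ) :
    ∃ k : X → ℝ, MemLp k (ENNReal.ofReal q) μ ∧ ∀ f : X → ℝ, ∫ x, f x ∂ν = ∫ x, f x * k x ∂μ := by
  have hac : ν ≪ μ := absolutelyContinuous_of_lintegral_le_eLpNorm hqr.symm.pos hC h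
  set w : X → ℝ≥0 := fun x => (ν.rnDeriv μ x).toNNReal
  have hw : Measurable w := (Measure.measurable_rnDeriv ν μ).ennreal_toNNReal
  have hν : μ.withDensity (fun x => w x) = ν := by
    refine (withDensity_congr_ae ?_).trans (Measure.withDensity_rnDeriv_eq ν μ hac)
    exact (Measure.rnDeriv_lt_top ν μ).mono fun x hx => ENNReal.coe_toNNReal hx.ne
  refine ⟨fun x => w x, ⟨hw.coe_nnreal_real.aestronglyMeasurable, ?_⟩, fun f => ?_⟩
  · have hrpow := lintegral_rpow_le_of_continuous hqr hw hC fun f hf hs hf0 => by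
      refine le_trans (le_of_eq ?_) (h f hf hs hf0)
      rw [← hν, lintegral_withDensity_eq_lintegral_mul _ hw.coe_nnreal_ennreal
        hf.measurable.ennreal_ofReal]
      simp only [Pi.mul_apply, mul_comm]
    rw [eLpNorm_eq_lintegral_rpow_enorm_toReal (ENNReal.ofReal_pos.2 hqr.pos).ne'
      ENNReal.ofReal_ne_top, ENNReal.toReal_ofReal hqr.nonneg]
    simp only [NNReal.enorm_eq]
    exact ENNReal.rpow_lt_top_of_nonneg hqr.one_div_nonneg
      (hrpow.trans_lt (ENNReal.rpow_lt_top_of_nonneg hqr.nonneg hC)).ne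
  · rw [← hν, integral_withDensity_eq_integral_smul hw]
    simp only [NNReal.smul_def, smul_eq_mul, mul_comm]

open scoped CompactlySupported in
theorem exists_regular_tendsto_of_nonneg {g : ι → X → ℝ} (hg0 : ∀ n x, 0 ≤ g n x)
    (hg : ∀ n, LocallyIntegrable (g n) μ)
    (hb : ∀ f : X → ℝ, Continuous f → HasCompactSupport f → ∃ C, ∀ n, |∫ x, f x * g n x ∂μ| ≤ C)
    (𝒰 : Ultrafilter ι) :
    ∃ ν : Measure X, ν.Regular ∧ ∀ f : X → ℝ, Continuous f → HasCompactSupport f →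
      Tendsto (fun n => ∫ x, f x * g n x ∂μ) 𝒰 (𝓝 (∫ x, f x ∂ν)) := by
  have hlim (f : C_c(X, ℝ)) : ∃ L, Tendsto (fun n => ∫ x, f x * g n x ∂μ) 𝒰 (𝓝 L) := by
    obtain ⟨C, hC⟩ := hb f f.continuous f.hasCompactSupport
    obtain ⟨L, -, hL⟩ := (isCompact_Icc (a := -C) (b := C)).ultrafilter_le_nhds'
      (𝒰.map fun n => ∫ x, f x * g n x ∂μ) (Ultrafilter.mem_map.2
        (Filter.univ_mem' fun n => abs_le.1 (hC n)))
    exact ⟨L, hL⟩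
  choose L hL using hlim
  have hint (f : C_c(X, ℝ)) (n : ι) : Integrable (fun x => f x * g n x) μ :=
    (hg n).integrable_smul_left_of_hasCompactSupport f.continuous f.hasCompactSupport
  let L₀ : C_c(X, ℝ) →ₗ[ℝ] ℝ :=
    { toFun := L
      map_add' f₁ f₂ := by
        refine tendsto_nhds_unique (hL (f₁ + f₂)) (((hL f₁).add (hL f₂)).congr fun n => ?_)
        rw [← integral_add (hint f₁ n) (hint f₂ n)]
        simp only [CompactlySupportedContinuousMap.add_apply, add_mul]
      map_smul' c f := by
        refine tendsto_nhds_unique (hL (c • f)) (((hL f).const_mul c).congr fun n => ?_)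
        rw [← integral_const_mul]
        simp only [CompactlySupportedContinuousMap.smul_apply, smul_eq_mul, mul_assoc] }
  let Λ : C_c(X, ℝ) →ₚ[ℝ] ℝ := PositiveLinearMap.mk₀ L₀ fun f hf =>
    ge_of_tendsto (hL f) (Eventually.of_forall fun n =>
      integral_nonneg fun x => mul_nonneg (hf x) (hg0 n x))
  refine ⟨RealRMK.rieszMeasure Λ, inferInstance, fun f hf hs => ?_⟩
  have hΛ : ∫ x, f x ∂(RealRMK.rieszMeasure Λ) = L ⟨⟨f, hf⟩, hs⟩ :=
    RealRMK.integral_rieszMeasure Λ ⟨⟨f, hf⟩, hs⟩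
  exact hΛ ▸ hL ⟨⟨f, hf⟩, hs⟩

theorem exists_isFiniteMeasure_tendsto_of_nonneg {g : ι → X → ℝ} (hg0 : ∀ n x, 0 ≤ g n x)
    (hg : ∀ n, Integrable (g n) μ) {C : ℝ} (hC : ∀ n, ∫ x, g n x ∂μ ≤ C) (𝒰 : Ultrafilter ι) :
    ∃ ν : Measure X, IsFiniteMeasure ν ∧ ∀ f : X → ℝ, Continuous f → HasCompactSupport f →
      Tendsto (fun n => ∫ x, f x * g n x ∂μ) 𝒰 (𝓝 (∫ x, f x ∂ν)) := by
  have hle {f : X → ℝ} {B : ℝ} (hB0 : 0 ≤ B) (hB : ∀ x, |f x| ≤ B) (n : ι) :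
      |∫ x, f x * g n x ∂μ| ≤ B * C := by
    rw [← Real.norm_eq_abs]
    refine (norm_integral_le_of_norm_le ((hg n).const_mul B) (ae_of_all _ fun x => ?_)).trans ?_
    · rw [norm_mul, Real.norm_of_nonneg (hg0 n x)]
      exact mul_le_mul_of_nonneg_right (hB x) (hg0 n x)
    · rw [integral_const_mul]
      exact mul_le_mul_of_nonneg_left (hC n) hB0
  obtain ⟨ν, hν, hνlim⟩ := exists_regular_tendsto_of_nonneg hg0
    (fun n => (hg n).locallyIntegrable) (fun f hf hs => by
      obtain ⟨B, hB⟩ := hs.exists_bound_of_continuous hf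
      exact ⟨_, hle (le_max_right B 0) fun x => (hB x).trans (le_max_left B 0)⟩) 𝒰
  refine ⟨ν, ⟨(measure_le_of_forall_lintegral_le (C := ENNReal.ofReal C) isOpen_univ
    fun f hf hs _ hf01 => ?_).trans_lt ENNReal.ofReal_lt_top⟩, hνlim⟩
  rw [← ofReal_integral_eq_lintegral_ofReal (hf.integrable_of_hasCompactSupport hs)
    (ae_of_all _ fun x => (hf01 x).1)]
  refine ENNReal.ofReal_le_ofReal (le_of_tendsto (hνlim f hf hs) (Eventually.of_forall fun n => ?_))
  have := hle (f := f) zero_le_one (fun x => abs_le.2 ⟨by linarith [(hf01 x).1], (hf01 x).2⟩) n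
  exact (le_abs_self _).trans (this.trans_eq (one_mul C))

theorem exists_signedMeasure_tendsto [SecondCountableTopology X] {g : ι → X → ℝ}
    (hg : ∀ n, Integrable (g n) μ) {C : ℝ} (hC : ∀ n, ∫ x, |g n x| ∂μ ≤ C) (𝒰 : Ultrafilter ι) :
    ∃ κ : SignedMeasure X, ∀ f : X → ℝ, Continuous f → HasCompactSupport f →
      Tendsto (fun n => ∫ x, f x * g n x ∂μ) 𝒰 (𝓝 (∫ᵛ x, f x ∂<•κ)) := by
  obtain ⟨ν₁, _, hν₁⟩ := exists_isFiniteMeasure_tendsto_of_nonneg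
    (fun n x => le_max_right (g n x) 0) (fun n => (hg n).pos_part)
    (fun n => (integral_mono (hg n).pos_part (hg n).abs fun x =>
      max_le (le_abs_self _) (abs_nonneg _)).trans (hC n)) 𝒰
  obtain ⟨ν₂, _, hν₂⟩ := exists_isFiniteMeasure_tendsto_of_nonneg
    (fun n x => le_max_right (-g n x) 0) (fun n => (hg n).neg_part)
    (fun n => (integral_mono (hg n).neg_part (hg n).abs fun x =>
      max_le (neg_le_abs _) (abs_nonneg _)).trans (hC n)) 𝒰
  refine ⟨ν₁.toSignedMeasure - ν₂.toSignedMeasure, fun f hf hs => ?_⟩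
  have hint (κ : SignedMeasure X) : κ.Integrable f :=
    hf.integrable_of_hasCompactSupport hs
  rw [VectorMeasure.integral_sub_vectorMeasure (hint _) (hint _),
    VectorMeasure.integral_toSignedMeasure, VectorMeasure.integral_toSignedMeasure]
  exact ((hν₁ f hf hs).sub (hν₂ f hf hs)).congr fun n =>
    integral_mul_posPart_sub_integral_mul_negPart hf hs (hg n).locallyIntegrable

theorem exists_memLp_tendsto_of_nonneg [SecondCountableTopology X] [μ.Regular]
    (hqr : q.HolderConjugate r) {g : ι → X → ℝ} (hg0 : ∀ n x, 0 ≤ g n x)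
    (hg : ∀ n, MemLp (g n) (ENNReal.ofReal q) μ) (hC : C ≠ ⊤)
    (hgC : ∀ n, eLpNorm (g n) (ENNReal.ofReal q) μ ≤ C) (𝒰 : Ultrafilter ι) :
    ∃ k : X → ℝ, MemLp k (ENNReal.ofReal q) μ ∧
      ∀ f : X → ℝ, Continuous f → HasCompactSupport f →
        Tendsto (fun n => ∫ x, f x * g n x ∂μ) 𝒰 (𝓝 (∫ x, f x * k x ∂μ)) := by
  have hle {f : X → ℝ} (hf : Continuous f) (n : ι) :
      ‖∫ x, f x * g n x ∂μ‖ₑ ≤ C * eLpNorm f (ENNReal.ofReal r) μ := by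
    rw [mul_comm]
    exact (enorm_integral_mul_le hqr hf.aestronglyMeasurable (hg n).1).trans
      (by gcongr; exact hgC n)
  obtain ⟨ν, _, hνlim⟩ := exists_regular_tendsto_of_nonneg hg0
    (fun n => (hg n).locallyIntegrable (ENNReal.one_le_ofReal.2 hqr.lt.le)) (fun f hf hs =>
      ⟨(C * eLpNorm f (ENNReal.ofReal r) μ).toReal, fun n => by
        rw [← Real.norm_eq_abs, ← toReal_enorm]
        exact ENNReal.toReal_mono (ENNReal.mul_ne_top hC
          (hf.memLp_of_hasCompactSupport hs).eLpNorm_ne_top) (hle hf n)⟩) 𝒰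
  obtain ⟨k, hk, hνk⟩ := exists_memLp_density (ν := ν) hqr hC fun f hf hs hf0 => by
    rw [← ofReal_integral_eq_lintegral_ofReal (hf.integrable_of_hasCompactSupport hs)
      (ae_of_all _ hf0)]
    exact le_of_tendsto (ENNReal.tendsto_ofReal (hνlim f hf hs))
      (Eventually.of_forall fun n => (Real.ofReal_le_enorm _).trans (hle hf n))
  exact ⟨k, hk, fun f hf hs => hνk f ▸ hνlim f hf hs⟩

theorem exists_memLp_tendsto [SecondCountableTopology X] [μ.Regular] (hqr : q.HolderConjugate r)
    {g : ι → X → ℝ} (hg : ∀ n, MemLp (g n) (ENNReal.ofReal q) μ) (hC : C ≠ ⊤)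
    (hgC : ∀ n, eLpNorm (g n) (ENNReal.ofReal q) μ ≤ C) (𝒰 : Ultrafilter ι) :
    ∃ k : X → ℝ, MemLp k (ENNReal.ofReal q) μ ∧
      ∀ f : X → ℝ, Continuous f → HasCompactSupport f →
        Tendsto (fun n => ∫ x, f x * g n x ∂μ) 𝒰 (𝓝 (∫ x, f x * k x ∂μ)) := by
  have hloc {k : X → ℝ} (hk : MemLp k (ENNReal.ofReal q) μ) : LocallyIntegrable k μ :=
    hk.locallyIntegrable (ENNReal.one_le_ofReal.2 hqr.lt.le)
  obtain ⟨k₁, hk₁, hlim₁⟩ := exists_memLp_tendsto_of_nonneg hqr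
    (fun n x => le_max_right (g n x) 0) (fun n => (hg n).pos_part) hC
    (fun n => (eLpNorm_mono (g := g n) fun x => by
      rcases le_total 0 (g n x) with h | h <;> simp [h]).trans (hgC n)) 𝒰
  obtain ⟨k₂, hk₂, hlim₂⟩ := exists_memLp_tendsto_of_nonneg hqr
    (fun n x => le_max_right (-g n x) 0) (fun n => (hg n).neg_part) hC
    (fun n => (eLpNorm_mono (g := g n) fun x => by
      rcases le_total 0 (g n x) with h | h <;> simp [h]).trans (hgC n)) 𝒰
  refine ⟨k₁ - k₂, hk₁.sub hk₂, fun f hf hs => ?_⟩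
  have hsub : ∫ x, f x * (k₁ - k₂) x ∂μ = ∫ x, f x * k₁ x ∂μ - ∫ x, f x * k₂ x ∂μ := by
    simp only [Pi.sub_apply, mul_sub]
    exact integral_sub ((hloc hk₁).integrable_smul_left_of_hasCompactSupport hf hs)
      ((hloc hk₂).integrable_smul_left_of_hasCompactSupport hf hs)
  rw [hsub]
  exact ((hlim₁ f hf hs).sub (hlim₂ f hf hs)).congr fun n =>
    integral_mul_posPart_sub_integral_mul_negPart hf hs (hloc (hg n))

end WeakCompactness

/-! ### Limits of bounded sequences of test functions -/

section Index

variable {N₁ : ℕ} {i : Fin N}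

theorem mem_firstIdx : i ∈ firstIdx N N₁ ↔ (i : ℕ) < N₁ := by
  simp only [firstIdx, Finset.mem_filter, Finset.mem_univ, true_and]

theorem mem_lastIdx : i ∈ lastIdx N N₁ ↔ N₁ ≤ (i : ℕ) := by
  simp only [lastIdx, Finset.mem_filter, Finset.mem_univ, true_and]

theorem sum_firstIdx_add_sum_lastIdx {M : Type*} [AddCommMonoid M] (N₁ : ℕ) (f : Fin N → M) :
    ∑ i ∈ firstIdx N N₁, f i + ∑ i ∈ lastIdx N N₁, f i = ∑ i, f i := by
  rw [← Finset.sum_filter_add_sum_filter_not Finset.univ fun i : Fin N => (i : ℕ) < N₁]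
  simp only [firstIdx, lastIdx, not_lt]

theorem derivNorm_of_lt (p : Fin N → ℝ) (D : Grad N) (hi : (i : ℕ) < N₁) :
    derivNorm N₁ p D i = totalMass {i} D.meas :=
  if_pos hi

theorem derivNorm_of_le (p : Fin N → ℝ) (D : Grad N) (hi : N₁ ≤ (i : ℕ)) :
    derivNorm N₁ p D i = eLpNorm (D.func i) (ENNReal.ofReal (p i)) volume :=
  if_neg hi.not_gt

end Index

section Limits

variable {N₁ : ℕ} {p : Fin N → ℝ}

theorem AdmissibleExponents.eLpNorm_pderiv_le_testNorm (hp : AdmissibleExponents N₁ p)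
    (φ : ℝ^N → ℝ) (i : Fin N) :
    eLpNorm (pderiv i φ) (ENNReal.ofReal (p i)) volume ≤ testNorm N₁ p φ := by
  rcases lt_or_ge (i : ℕ) N₁ with hi | hi
  · rw [hp.eq_one i hi, ENNReal.ofReal_one]
    refine (eLpNorm_mono_real fun x => ?_).trans le_self_add
    exact Real.abs_le_sqrt (Finset.single_le_sum (f := fun i => pderiv i φ x ^ 2)
      (fun j _ => sq_nonneg _) (mem_firstIdx.2 hi))
  · exact (Finset.single_le_sum
      (f := fun i => eLpNorm (pderiv i φ) (ENNReal.ofReal (p i)) volume)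
      (fun j _ => zero_le) (mem_lastIdx.2 hi)).trans le_add_self

theorem AdmissibleExponents.exists_eLpNorm_le_mul_testNorm (hp : AdmissibleExponents N₁ p) :
    ∃ K : ℝ≥0∞, K ≠ ⊤ ∧ ∀ φ : ℝ^N → ℝ, IsTest φ →
      eLpNorm φ (ENNReal.ofReal (critExp p)) volume ≤ K * testNorm N₁ p φ := by
  obtain ⟨T₀, hT₀, hT⟩ := exists_troisi_test hp.one_le hp.one_lt_sum
  have hT₀' : ENNReal.ofReal T₀ ≠ 0 := (ENNReal.ofReal_pos.2 hT₀).ne'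
  have hN : (N : ℝ) ≠ 0 := by
    have := two_le_dim hp.one_le hp.one_lt_sum
    positivity
  refine ⟨(ENNReal.ofReal T₀)⁻¹, ENNReal.inv_ne_top.2 hT₀', fun φ hφ => ?_⟩
  rw [← ENNReal.mul_le_iff_le_inv hT₀' ENNReal.ofReal_ne_top]
  calc ENNReal.ofReal T₀ * eLpNorm φ (ENNReal.ofReal (critExp p)) volume
      ≤ ∏ i, eLpNorm (pderiv i φ) (ENNReal.ofReal (p i)) volume ^ (1 / (N : ℝ)) := hT φ hφ
    _ ≤ ∏ _i : Fin N, testNorm N₁ p φ ^ (1 / (N : ℝ)) := by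
        gcongr with i
        exact hp.eLpNorm_pderiv_le_testNorm φ i
    _ = testNorm N₁ p φ := by
        rw [Finset.prod_const, Finset.card_univ, Fintype.card_fin, ← ENNReal.rpow_mul_natCast,
          one_div_mul_cancel hN, ENNReal.rpow_one]

namespace ConvergesInDistributions

variable {us : ℕ → ℝ^N → ℝ} {u : ℝ^N → ℝ} (hu : ConvergesInDistributions us u)
include hu

theorem tendsto_integral_mul_pderiv (hus : ∀ n, IsTest (us n)) (i : Fin N) {φ : ℝ^N → ℝ}
    (hφ : IsTest φ) : Tendsto (fun n => ∫ x, φ x * pderiv i (us n) x) atTop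
      (𝓝 (- ∫ x, u x * pderiv i φ x)) := by
  refine (hu.2 _ (hφ.pderiv i)).neg.congr fun n => ?_
  simp only [(hus n).hasWeakDeriv i φ hφ, neg_neg, mul_comm]

theorem memLp {q : ℝ} (hq : 1 < q) (hus : ∀ n, MemLp (us n) (ENNReal.ofReal q) volume) {C : ℝ≥0∞}
    (hC : C ≠ ⊤) (hle : ∀ n, eLpNorm (us n) (ENNReal.ofReal q) volume ≤ C) :
    MemLp u (ENNReal.ofReal q) volume := by
  obtain ⟨k, hk, hlim⟩ := exists_memLp_tendsto (Real.HolderConjugate.conjExponent hq) hus hC hle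
    (hyperfilter ℕ)
  have hint (φ : ℝ^N → ℝ) (hφ : ContDiff ℝ ∞ φ) (hφs : HasCompactSupport φ) :
      ∫ x, φ x • u x = ∫ x, φ x • k x := by
    have hlim_u := (hu.2 φ ⟨hφ, hφs⟩).mono_left Nat.hyperfilter_le_atTop
    simp only [mul_comm _ (φ _)] at hlim_u
    exact tendsto_nhds_unique hlim_u (hlim φ hφ.continuous hφs)
  have hk_loc := hk.locallyIntegrable (ENNReal.one_le_ofReal.2 hq.le)
  have huk : u =ᵐ[volume] k := ae_eq_of_integral_contDiff_smul_eq hu.1 hk_loc hint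
  exact hk.ae_eq huk.symm

theorem exists_hasMeasureDeriv (hus : ∀ n, IsTest (us n)) {i : Fin N} {C : ℝ≥0∞} (hC : C ≠ ⊤)
    (hle : ∀ n, eLpNorm (pderiv i (us n)) 1 volume ≤ C) :
    ∃ μ : SignedMeasure (ℝ^N), HasMeasureDeriv u i μ := by
  have hint (n : ℕ) : ∫ x, |pderiv i (us n) x| ≤ C.toReal := by
    refine (integral_norm_eq_lintegral_enorm ((hus n).pderiv i).integrable.1).trans_le
      (ENNReal.toReal_mono hC ?_)
    rw [← eLpNorm_one_eq_lintegral_enorm]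
    exact hle n
  obtain ⟨μ, hμ⟩ := exists_signedMeasure_tendsto (fun n => ((hus n).pderiv i).integrable) hint
    (hyperfilter ℕ)
  refine ⟨μ, fun φ hφ => neg_eq_iff_eq_neg.1 ?_⟩
  exact tendsto_nhds_unique
    ((hu.tendsto_integral_mul_pderiv hus i hφ).mono_left Nat.hyperfilter_le_atTop)
    (hμ φ hφ.continuous hφ.2)

theorem exists_memLp_hasWeakDeriv (hus : ∀ n, IsTest (us n)) {i : Fin N} {q : ℝ} (hq : 1 < q)
    {C : ℝ≥0∞} (hC : C ≠ ⊤) (hle : ∀ n, eLpNorm (pderiv i (us n)) (ENNReal.ofReal q) volume ≤ C) :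
    ∃ g : ℝ^N → ℝ, MemLp g (ENNReal.ofReal q) volume ∧ HasWeakDeriv u i g := by
  obtain ⟨g, hg, hlim⟩ := exists_memLp_tendsto (Real.HolderConjugate.conjExponent hq)
    (fun n => ((hus n).pderiv i).memLp _) hC hle (hyperfilter ℕ)
  refine ⟨g, hg, fun φ hφ => neg_eq_iff_eq_neg.1 ?_⟩
  simp only [mul_comm (g _)]
  exact tendsto_nhds_unique
    ((hu.tendsto_integral_mul_pderiv hus i hφ).mono_left Nat.hyperfilter_le_atTop)
    (hlim φ hφ.continuous hφ.2)

theorem mem_BV (hp : AdmissibleExponents N₁ p) (hus : ∀ n, IsTest (us n)) {C : ℝ≥0∞} (hC : C ≠ ⊤)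
    (hle : ∀ n, testNorm N₁ p (us n) ≤ C) : u ∈ BV N₁ p := by
  obtain ⟨K, hK, hsob⟩ := hp.exists_eLpNorm_le_mul_testNorm
  have hderiv (n : ℕ) (i : Fin N) :
      eLpNorm (pderiv i (us n)) (ENNReal.ofReal (p i)) volume ≤ C :=
    (hp.eLpNorm_pderiv_le_testNorm (us n) i).trans (hle n)
  refine ⟨hu.memLp hp.one_lt_critExp (fun n => (hus n).memLp _) (ENNReal.mul_ne_top hK hC)
    fun n => (hsob _ (hus n)).trans (mul_le_mul_right (hle n) K), fun i hi => ?_, fun i hi => ?_⟩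
  · refine hu.exists_hasMeasureDeriv hus hC fun n => ?_
    simpa only [hp.eq_one i (mem_firstIdx.1 hi), ENNReal.ofReal_one] using hderiv n i
  · exact hu.exists_memLp_hasWeakDeriv hus (hp.one_lt i (mem_lastIdx.1 hi)) hC fun n => hderiv n i

end ConvergesInDistributions

end Limits

/-! ### Tight convergence of the approximations -/

theorem tendsto_eLpNorm_of_tendsto_sub {X E : Type*} [MeasurableSpace X] {μ : Measure X}
    [NormedAddCommGroup E] {ι : Type*} {l : Filter ι} {q : ℝ≥0∞} (hq : 1 ≤ q) {f : ι → X → E}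
    {g : X → E} (hf : ∀ n, MemLp (f n) q μ) (hg : MemLp g q μ)
    (h : Tendsto (fun n => eLpNorm (f n - g) q μ) l (𝓝 0)) :
    Tendsto (fun n => eLpNorm (f n) q μ) l (𝓝 (eLpNorm g q μ)) := by
  have : Fact (1 ≤ q) := ⟨hq⟩
  simpa only [Lp.enorm_toLp] using ((Lp.tendsto_Lp_iff_tendsto_eLpNorm'' f hf g hg).2 h).enorm

theorem integral_abs_rpow_eq_toReal_eLpNorm_rpow {X : Type*} [MeasurableSpace X] {μ : Measure X}
    {q : ℝ} (hq : 0 < q) {f : X → ℝ} (hf : AEStronglyMeasurable f μ) :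
    ∫ x, |f x| ^ q ∂μ = (eLpNorm f (ENNReal.ofReal q) μ).toReal ^ q := by
  rw [toReal_eLpNorm hf, lpNorm_eq_integral_norm_rpow_toReal (ENNReal.ofReal_pos.2 hq).ne'
    ENNReal.ofReal_ne_top hf, ENNReal.toReal_ofReal hq.le,
    Real.rpow_inv_rpow (integral_nonneg fun x => by positivity) hq.ne']
  simp only [Real.norm_eq_abs]

theorem weakLp_of_tendsto_eLpNorm_sub {q : ℝ} (hq : 1 < q) {f : ℕ → ℝ^N → ℝ} {g : ℝ^N → ℝ}
    (hf : ∀ n, MemLp (f n) (ENNReal.ofReal q) volume) (hg : MemLp g (ENNReal.ofReal q) volume)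
    (h : Tendsto (fun n => eLpNorm (f n - g) (ENNReal.ofReal q) volume) atTop (𝓝 0)) :
    WeakLp q f g := by
  have hqr := Real.HolderConjugate.conjExponent hq
  intro v (hv : MemLp v (ENNReal.ofReal q.conjExponent) volume)
  have := hqr.ennrealOfReal
  have hbound : Tendsto (fun n => eLpNorm (f n - g) (ENNReal.ofReal q) volume *
      eLpNorm v (ENNReal.ofReal q.conjExponent) volume) atTop (𝓝 0) := by
    simpa only [zero_mul] using ENNReal.Tendsto.mul_const h (Or.inr hv.eLpNorm_ne_top)
  rw [tendsto_iff_edist_tendsto_0]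
  refine tendsto_of_tendsto_of_tendsto_of_le_of_le tendsto_const_nhds hbound (fun _ => zero_le)
    fun n => ?_
  have hsub : ∫ x, (f n - g) x * v x = (∫ x, f n x * v x) - ∫ x, g x * v x := by
    simp only [Pi.sub_apply, sub_mul]
    exact integral_sub ((hf n).integrable_mul hv) (hg.integrable_mul hv)
  rw [edist_eq_enorm_sub, ← hsub]
  exact enorm_integral_mul_le hqr.symm ((hf n).sub hg).1 hv.1

theorem exists_forall_le_ofReal_of_tendsto {a : ℕ → ℝ≥0∞} (ha : ∀ n, a n ≠ ⊤) {L : ℝ≥0∞}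
    (hL : L ≠ ⊤) (h : Tendsto a atTop (𝓝 L)) : ∃ C : ℝ, ∀ n, a n ≤ ENNReal.ofReal C := by
  obtain ⟨C, hC⟩ := ((ENNReal.tendsto_toReal hL).comp h).bddAbove_range
  exact ⟨C, fun n => (ENNReal.ofReal_toReal (ha n)).ge.trans
    (ENNReal.ofReal_le_ofReal (hC ⟨n, rfl⟩))⟩

section DerivNorm

variable {N₁ : ℕ} {p : Fin N → ℝ} {φ u : ℝ^N → ℝ} {D : Grad N}

theorem IsBVGrad.derivNorm_ne_top (hD : IsBVGrad N₁ p u D) (i : Fin N) :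
    derivNorm N₁ p D i ≠ ⊤ := by
  rcases lt_or_ge (i : ℕ) N₁ with hi | hi
  · exact derivNorm_of_lt p D hi ▸ (totalMass_lt_top _ _).ne
  · exact derivNorm_of_le p D hi ▸ (hD.func_memLp i (mem_lastIdx.2 hi)).eLpNorm_ne_top

theorem IsTest.eLpNorm_pderiv_le_derivNorm (hp_one : ∀ i : Fin N, (i : ℕ) < N₁ → p i = 1)
    (hφ : IsTest φ) (i : Fin N) :
    eLpNorm (pderiv i φ) (ENNReal.ofReal (p i)) volume ≤ derivNorm N₁ p (testGrad φ) i := by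
  rcases lt_or_ge (i : ℕ) N₁ with hi | hi
  · rw [derivNorm_of_lt p (testGrad φ) hi, hp_one i hi, ENNReal.ofReal_one]
    exact hφ.eLpNorm_pderiv_le_totalMass i
  · exact (derivNorm_of_le p (testGrad φ) hi).ge

theorem IsTest.testNorm_le_sum_derivNorm (hp_one : ∀ i : Fin N, (i : ℕ) < N₁ → p i = 1)
    (hφ : IsTest φ) : testNorm N₁ p φ ≤ ∑ i, derivNorm N₁ p (testGrad φ) i := by
  have hsqrt (x : ℝ^N) : √(∑ i ∈ firstIdx N N₁, pderiv i φ x ^ 2) ≤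
      ∑ i ∈ firstIdx N N₁, |pderiv i φ x| := by
    have h0 : 0 ≤ ∑ i ∈ firstIdx N N₁, |pderiv i φ x| := Finset.sum_nonneg fun _ _ => abs_nonneg _
    simp only [← sq_abs (pderiv _ φ x)]
    exact Real.sqrt_le_iff.2 ⟨h0, Finset.sum_sq_le_sq_sum_of_nonneg fun _ _ => abs_nonneg _⟩
  have hfirst : eLpNorm (fun x => √(∑ i ∈ firstIdx N N₁, pderiv i φ x ^ 2)) 1 volume ≤
      ∑ i ∈ firstIdx N N₁, eLpNorm (pderiv i φ) 1 volume := by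
    calc eLpNorm (fun x => √(∑ i ∈ firstIdx N N₁, pderiv i φ x ^ 2)) 1 volume
        ≤ eLpNorm (∑ i ∈ firstIdx N N₁, fun x => ‖pderiv i φ x‖) 1 volume :=
          eLpNorm_mono_real fun x => by
            rw [Finset.sum_apply, Real.norm_of_nonneg (Real.sqrt_nonneg _)]
            exact hsqrt x
      _ ≤ ∑ i ∈ firstIdx N N₁, eLpNorm (fun x => ‖pderiv i φ x‖) 1 volume :=
          eLpNorm_sum_le (fun i _ => (hφ.pderiv i).integrable.1.norm) le_rfl
      _ = ∑ i ∈ firstIdx N N₁, eLpNorm (pderiv i φ) 1 volume := by simp only [eLpNorm_norm]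
  rw [← sum_firstIdx_add_sum_lastIdx N₁]
  refine add_le_add (hfirst.trans (Finset.sum_le_sum fun i hi => ?_))
    (Finset.sum_le_sum fun i _ => hφ.eLpNorm_pderiv_le_derivNorm hp_one i)
  have hle := hφ.eLpNorm_pderiv_le_derivNorm hp_one i
  rwa [hp_one i (mem_firstIdx.1 hi), ENNReal.ofReal_one] at hle

namespace IsTestApprox

variable {us : ℕ → ℝ^N → ℝ} (h : IsTestApprox N₁ p us u D)
include h

theorem tendsto_totalMass {S : Finset (Fin N)} (hS : S ⊆ firstIdx N N₁) :
    Tendsto (fun n => totalMass S (testGrad (us n)).meas) atTop (𝓝 (totalMass S D.meas)) := by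
  obtain ⟨ε, hε, hle⟩ := h.exists_error
  exact AnisoBV.tendsto_totalMass (fun i hi => h.vague i (hS hi)) hε (hle S hS)

theorem tendsto_eLpNorm_pderiv (hp : AdmissibleExponents N₁ p) (hD : IsBVGrad N₁ p u D)
    {i : Fin N} (hi : i ∈ lastIdx N N₁) :
    Tendsto (fun n => eLpNorm (pderiv i (us n)) (ENNReal.ofReal (p i)) volume) atTop
      (𝓝 (eLpNorm (D.func i) (ENNReal.ofReal (p i)) volume)) :=
  tendsto_eLpNorm_of_tendsto_sub (ENNReal.one_le_ofReal.2 (hp.one_le i))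
    (fun n => ((h.isTest n).pderiv i).memLp _) (hD.func_memLp i hi) (h.tendsto_pderiv_sub i hi)

theorem tendsto_derivNorm (hp : AdmissibleExponents N₁ p) (hD : IsBVGrad N₁ p u D) (i : Fin N) :
    Tendsto (fun n => derivNorm N₁ p (testGrad (us n)) i) atTop (𝓝 (derivNorm N₁ p D i)) := by
  rcases lt_or_ge (i : ℕ) N₁ with hi | hi
  · simp only [derivNorm_of_lt p _ hi]
    exact h.tendsto_totalMass (Finset.singleton_subset_iff.2 (mem_firstIdx.2 hi))
  · simp only [derivNorm_of_le p _ hi]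
    exact h.tendsto_eLpNorm_pderiv hp hD (mem_lastIdx.2 hi)

theorem weakLp (hp : AdmissibleExponents N₁ p) (hD : IsBVGrad N₁ p u D) :
    WeakLp (critExp p) us u :=
  weakLp_of_tendsto_eLpNorm_sub hp.one_lt_critExp (fun n => (h.isTest n).memLp _) hD.memLp
    h.tendsto_sub

theorem convergesTightly (hp : AdmissibleExponents N₁ p) (hD : IsBVGrad N₁ p u D) :
    ConvergesTightly N₁ p us u := by
  have hmemLp (i : Fin N) (n : ℕ) : MemLp (pderiv i (us n)) (ENNReal.ofReal (p i)) volume :=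
    ((h.isTest n).pderiv i).memLp _
  refine ⟨fun n => testGrad (us n), D,
    ⟨fun n => (h.isTest n).isBVGrad N₁ p, hD, h.weakLp hp hD, h.vague, fun i hi => ?_⟩,
    fun i hi => ?_, h.tendsto_totalMass subset_rfl⟩
  · exact weakLp_of_tendsto_eLpNorm_sub (hp.one_lt i (mem_lastIdx.1 hi)) (hmemLp i)
      (hD.func_memLp i hi) (h.tendsto_pderiv_sub i hi)
  · have hlim := ((ENNReal.tendsto_toReal (hD.func_memLp i hi).eLpNorm_ne_top).comp
      (h.tendsto_eLpNorm_pderiv hp hD hi)).rpow_const (p := p i) (Or.inr (hp.pos i).le)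
    rw [integral_abs_rpow_eq_toReal_eLpNorm_rpow (hp.pos i) (hD.func_memLp i hi).1]
    exact hlim.congr fun n =>
      (integral_abs_rpow_eq_toReal_eLpNorm_rpow (hp.pos i) (hmemLp i n).1).symm

theorem exists_testNorm_le (hp : AdmissibleExponents N₁ p) (hD : IsBVGrad N₁ p u D) :
    ∃ C : ℝ, ∀ n, testNorm N₁ p (us n) ≤ ENNReal.ofReal C := by
  obtain ⟨C, hC⟩ := exists_forall_le_ofReal_of_tendsto
    (fun n => ENNReal.sum_ne_top.2 fun i _ => ((h.isTest n).isBVGrad N₁ p).derivNorm_ne_top i)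
    (ENNReal.sum_ne_top.2 fun i _ => hD.derivNorm_ne_top i)
    (tendsto_finsetSum Finset.univ fun i _ => h.tendsto_derivNorm hp hD i)
  exact ⟨C, fun n => ((h.isTest n).testNorm_le_sum_derivNorm hp.eq_one).trans (hC n)⟩

theorem convergesInDistributions (hp : AdmissibleExponents N₁ p) (hD : IsBVGrad N₁ p u D) :
    ConvergesInDistributions us u :=
  ⟨hD.memLp.locallyIntegrable hp.one_le_ofReal_critExp,
    fun _ hφ => h.weakLp hp hD _ (hφ.memLp _)⟩

end IsTestApprox

/-! ### The Troisi inequalities in `BV^p` -/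

theorem troisi_of_forall_test (hp : AdmissibleExponents N₁ p) {T₀ : ℝ}
    (hT : ∀ φ : ℝ^N → ℝ, IsTest φ →
      ENNReal.ofReal T₀ * eLpNorm φ (ENNReal.ofReal (critExp p)) volume ≤
        ∏ i, eLpNorm (pderiv i φ) (ENNReal.ofReal (p i)) volume ^ (1 / (N : ℝ)))
    (hD : IsBVGrad N₁ p u D) :
    ENNReal.ofReal T₀ * eLpNorm u (ENNReal.ofReal (critExp p)) volume ≤
      ∏ i, derivNorm N₁ p D i ^ (1 / (N : ℝ)) := by
  obtain ⟨us, h⟩ := exists_isTestApprox hp hD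
  have hleft := ENNReal.Tendsto.const_mul (a := ENNReal.ofReal T₀)
    (tendsto_eLpNorm_of_tendsto_sub hp.one_le_ofReal_critExp (fun n => (h.isTest n).memLp _)
      hD.memLp h.tendsto_sub) (Or.inr ENNReal.ofReal_ne_top)
  have hright := ENNReal.tendsto_finsetProd_of_ne_top Finset.univ
    (fun i _ => (h.tendsto_derivNorm hp hD i).ennrpow_const (1 / (N : ℝ)))
    fun i _ => ENNReal.rpow_ne_top_of_nonneg (by positivity) (hD.derivNorm_ne_top i)
  refine le_of_tendsto_of_tendsto' hleft hright fun n => (hT _ (h.isTest n)).trans ?_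
  gcongr with i
  exact (h.isTest n).eLpNorm_pderiv_le_derivNorm hp.eq_one i

end DerivNorm

theorem prod_rpow_inv_card_le {ι : Type*} [Fintype ι] [Nonempty ι] (a : ι → ℝ≥0∞) :
    ∏ i, a i ^ (1 / (Fintype.card ι : ℝ)) ≤
      ENNReal.ofReal (1 / Fintype.card ι) * ∑ i, a i := by
  have hcard : (0 : ℝ) < Fintype.card ι := mod_cast Fintype.card_pos
  by_cases ha : ∀ i, a i ≠ ⊤
  · lift a to ι → NNReal using ha
    have hamgm := NNReal.geom_mean_le_arith_mean_weighted Finset.univ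
      (fun _ => (1 / Fintype.card ι : NNReal)) a (by simp)
    rw [← Finset.mul_sum] at hamgm
    have hweight :
        ENNReal.ofReal (1 / Fintype.card ι) = ((1 / Fintype.card ι : NNReal) : ℝ≥0∞) := by
      rw [← ENNReal.ofReal_coe_nnreal, NNReal.coe_div, NNReal.coe_one, NNReal.coe_natCast]
    simp only [hweight, ← ENNReal.coe_rpow_of_nonneg _ (one_div_nonneg.2 hcard.le)]
    exact_mod_cast hamgm
  · push Not at ha
    rw [ENNReal.sum_eq_top.2 (by simpa using ha), ENNReal.mul_top
      (ENNReal.ofReal_pos.2 (one_div_pos.2 hcard)).ne']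
    exact le_top

theorem sum_derivNorm_le {N₁ : ℕ} (hN₁ : N₁ ≤ N) (p : Fin N → ℝ) (D : Grad N) :
    ∑ i, derivNorm N₁ p D i ≤
      ENNReal.ofReal √(N₁ : ℝ) * mass₁ N₁ D + ∑ i ∈ lastIdx N N₁, derivNorm N₁ p D i := by
  have hcard : (firstIdx N N₁).card = N₁ := by
    rw [firstIdx, Fin.card_filter_val_lt, min_eq_right hN₁]
  rw [← sum_firstIdx_add_sum_lastIdx N₁]
  gcongr
  calc ∑ i ∈ firstIdx N N₁, derivNorm N₁ p D i
      = ∑ i ∈ firstIdx N N₁, totalMass {i} D.meas :=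
        Finset.sum_congr rfl fun i hi => derivNorm_of_lt p D (mem_firstIdx.1 hi)
    _ ≤ ENNReal.ofReal √(N₁ : ℝ) * mass₁ N₁ D := by
        simpa only [hcard, mass₁] using sum_totalMass_singleton_le (firstIdx N N₁) D.meas

theorem troisiIneq_of_forall_test {N₁ : ℕ} {p : Fin N → ℝ} (hp : AdmissibleExponents N₁ p)
    (hN₁ : N₁ ≤ N) {T₀ : ℝ} (hT₀ : 0 < T₀)
    (hT : ∀ φ : ℝ^N → ℝ, IsTest φ →
      ENNReal.ofReal T₀ * eLpNorm φ (ENNReal.ofReal (critExp p)) volume ≤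
        ∏ i, eLpNorm (pderiv i φ) (ENNReal.ofReal (p i)) volume ^ (1 / (N : ℝ)))
    {u : ℝ^N → ℝ} {D : Grad N} (hD : IsBVGrad N₁ p u D) : TroisiIneq N₁ p T₀ u D := by
  have hprod := troisi_of_forall_test hp hT hD
  have : Nonempty (Fin N) := ⟨⟨0, by have := two_le_dim hp.one_le hp.one_lt_sum; omega⟩⟩
  have hamgm : ∏ i, derivNorm N₁ p D i ^ (1 / (N : ℝ)) ≤
      ENNReal.ofReal (1 / N) * ∑ i, derivNorm N₁ p D i := by
    simpa only [Fintype.card_fin] using prod_rpow_inv_card_le (derivNorm N₁ p D)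
  have hinv : ENNReal.ofReal (1 / T₀) * ENNReal.ofReal T₀ = 1 := by
    rw [← ENNReal.ofReal_mul (by positivity), one_div_mul_cancel hT₀.ne', ENNReal.ofReal_one]
  refine ⟨hprod, ?_⟩
  calc eLpNorm u (ENNReal.ofReal (critExp p)) volume
      = ENNReal.ofReal (1 / T₀) *
          (ENNReal.ofReal T₀ * eLpNorm u (ENNReal.ofReal (critExp p)) volume) := by
        rw [← mul_assoc, hinv, one_mul]
    _ ≤ ENNReal.ofReal (1 / T₀) * (ENNReal.ofReal (1 / N) * (ENNReal.ofReal √(N₁ : ℝ) * mass₁ N₁ D +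
          ∑ i ∈ lastIdx N N₁, derivNorm N₁ p D i)) := by
        exact mul_le_mul_right
          (hprod.trans (hamgm.trans (mul_le_mul_right (sum_derivNorm_le hN₁ p D) _))) _
    _ = ENNReal.ofReal (1 / (T₀ * N)) * (ENNReal.ofReal √(N₁ : ℝ) * mass₁ N₁ D +
          ∑ i ∈ lastIdx N N₁, derivNorm N₁ p D i) := by
        rw [← mul_assoc, ← ENNReal.ofReal_mul (by positivity), one_div_mul_one_div]

end AnisoBV

theorem mainTheorem5 (N N₁ : ℕ) (hN₁ : N₁ ≤ N) (p : Fin N → ℝ)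
    (hp_one : ∀ i : Fin N, (i : ℕ) < N₁ → p i = 1)
    (hp_gt : ∀ i : Fin N, N₁ ≤ (i : ℕ) → 1 < p i)
    (hp_sum : 1 < ∑ i, 1 / p i)
    (hp_crit : ∀ i, p i < critExp p) :
    (∀ u : EuclideanSpace ℝ (Fin N) → ℝ,
      List.TFAE [
        u ∈ BV N₁ p,
        ∃ us : ℕ → EuclideanSpace ℝ (Fin N) → ℝ,
          (∀ n, IsTest (us n)) ∧ ConvergesTightly N₁ p us u,
        ∃ us : ℕ → EuclideanSpace ℝ (Fin N) → ℝ,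
          (∀ n, IsTest (us n)) ∧ ConvergesWeakly N₁ p us u,
        ∃ us : ℕ → EuclideanSpace ℝ (Fin N) → ℝ,
          (∀ n, IsTest (us n)) ∧ (∃ C : ℝ, ∀ n, testNorm N₁ p (us n) ≤ ENNReal.ofReal C) ∧
            ConvergesInDistributions us u]) ∧
    (∃ T₀ : ℝ, 0 < T₀ ∧ ∀ (u : EuclideanSpace ℝ (Fin N) → ℝ) (D : Grad N),
      IsBVGrad N₁ p u D → TroisiIneq N₁ p T₀ u D) ∧
    (∀ T₀ : ℝ, 0 < T₀ →
      (∀ φ : EuclideanSpace ℝ (Fin N) → ℝ, IsTest φ →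
        ENNReal.ofReal T₀ * eLpNorm φ (ENNReal.ofReal (critExp p)) volume
          ≤ ∏ i, eLpNorm (pderiv i φ) (ENNReal.ofReal (p i)) volume ^ (1 / (N : ℝ))) →
      ∀ (u : EuclideanSpace ℝ (Fin N) → ℝ) (D : Grad N),
        IsBVGrad N₁ p u D → TroisiIneq N₁ p T₀ u D) := by
  have hp : AdmissibleExponents N₁ p := ⟨hp_one, hp_gt, hp_sum, hp_crit⟩
  obtain ⟨T₀, hT₀, hT⟩ := exists_troisi_test hp.one_le hp.one_lt_sum
  refine ⟨fun u => ?_, ⟨T₀, hT₀, fun u D => troisiIneq_of_forall_test hp hN₁ hT₀ hT⟩,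
    fun T hT₀ hT u D => troisiIneq_of_forall_test hp hN₁ hT₀ hT⟩
  tfae_have 1 → 2 := fun hu => by
    obtain ⟨D, hD⟩ := mem_BV_iff.1 hu
    obtain ⟨us, h⟩ := exists_isTestApprox hp hD
    exact ⟨us, h.isTest, h.convergesTightly hp hD⟩
  tfae_have 2 → 3 := fun ⟨us, hus, Ds, D, h, _⟩ => ⟨us, hus, Ds, D, h⟩
  tfae_have 3 → 1 := fun ⟨_, _, _, D, h⟩ => mem_BV_iff.2 ⟨D, h.lim_grad⟩
  tfae_have 1 → 4 := fun hu => by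
    obtain ⟨D, hD⟩ := mem_BV_iff.1 hu
    obtain ⟨us, h⟩ := exists_isTestApprox hp hD
    exact ⟨us, h.isTest, h.exists_testNorm_le hp hD, h.convergesInDistributions hp hD⟩
  tfae_have 4 → 1 := fun ⟨_, hus, ⟨_, hC⟩, hu⟩ => hu.mem_BV hp hus ENNReal.ofReal_ne_top hC
  tfae_finish
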